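/- **Setting.** Let $(P_t)_{t\ge 0}$ be a semigroup of Markov kernels on a measurable space $E$ (for instance $E\subseteq\mathbb R$) with an invariant probability measure $\nu$, and write $P_t$ also for the induced contraction of $L^2(\nu)$, $P_t^*$ for its adjoint. Let $X=(X_t)_{t\ge0}$ be a (measurable) Markov process with semigroup $(P_t)$ and initial law $\nu$. Let $\mathtt N\subseteq\mathbb N$, let $(\lambda_n)_{n\in\mathtt N}$ be distinct non-negative numbers, and let $\mathcal P_n,\mathcal V_n\in L^2(\nu)$ satisfy $P_t\mathcal P_n=e^{-\lambda_n t}\mathcal P_n$ and $P_t^*\mathcal V_n=e^{-\lambda_n t}\mathcal V_n$ for all $t\ge0$, and $\langle\mathcal P_n,\mathcal V_n\rangle_\nu=1$, for every $n\in\mathtt N$. Put $$c_\nu(n,m)=\frac{\langle \mathcal P_n,\mathcal P_m\rangle_\nu}{\|\mathcal P_n\|_\nu\|\mathcal P_m\|_\nu},\qquad \kappa_\nu(m)=\|\mathcal P_m\|_\nu\|\mathcal V_m\|_\nu .$$ Let $\mathcal T=(\mathcal T_t)_{t\ge0}$ be a subordinator (a real-valued Lévy process with non-decreasing right-continuous paths)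 independent of $X$, let $L_t=\inf\{s>0:\mathcal T_s>t\}$, and assume that $L_t<\infty$ almost surely for all $t\ge0$. Write $\eta_t(\lambda)=\mathbb E[e^{-\lambda L_t}]$, let $U(dr)=\int_0^\infty\mathbb P(\mathcal T_v\in dr)\,dv$ be the renewal measure of $\mathcal T$, and let $\rho_\nu(f(X_{L_t}),g(X_{L_s}))$ be the correlation (covariance divided by the product of the standard deviations, and $0$ if that product is $0$) of $f(X_{L_t})$ and $g(X_{L_s})$ when $X_0$ has law $\nu$. **Theorem.** Let $m,n\in\mathtt N$ with $\lambda_m,\lambda_n>0$. The random variables $\mathcal P_m(X_{L_t})$, $\mathcal V_m(X_{L_t})$ ($t>0$) are square-integrable, $\mathbb E[L_s]<\infty$ ($s>0$), the integral below is finite, and the following hold. 1. For $t\ge s>0$, $$\rho_\nu(\mathcal P_m(X_{L_t}),\mathcal P_n(X_{L_s}))=c_\nu(n,m)\Big(\lambda_m\int_{[0,s]}\eta_{t-r}(\lambda_m)\,U(dr)+\eta_t(\lambda_m)\Big),$$ $$\rho_\nu(\mathcal P_m(X_{L_t}),\mathcal V_n(X_{L_s}))=\kappa_\nu^{-1}(m)\,\delta_{mn}\Big(\lambda_m\int_{[0,s]}\eta_{t-r}(\lambda_m)\,U(dr)+\eta_t(\lambda_m)\Big).$$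 2. For $t\ge s>0$, if $c_\nu(n,m)\ge0$, then $$c_\nu(n,m)\,\eta_t(\lambda_m)(\lambda_m\mathbb E[L_s]+1)\le\rho_\nu(\mathcal P_m(X_{L_t}),\mathcal P_n(X_{L_s}))\le c_\nu(n,m)\,\eta_{t-s}(\lambda_m)(\lambda_m\mathbb E[L_s]+1),$$ and both inequalities are reversed if $c_\nu(n,m)\le0$; moreover $$\kappa_\nu^{-1}(m)\delta_{mn}\,\eta_t(\lambda_m)(\lambda_m\mathbb E[L_s]+1)\le\rho_\nu(\mathcal P_m(X_{L_t}),\mathcal V_n(X_{L_s}))\le\kappa_\nu^{-1}(m)\delta_{mn}\,\eta_{t-s}(\lambda_m)(\lambda_m\mathbb E[L_s]+1).$$ 3. If, for some fixed $s>0$, $\limsup_{t\to\infty}\eta_{t-s}(\lambda_m)/\eta_t(\lambda_m)$ is finite, then there is $t_0>0$ such that, as functions of $t\ge t_0$, $$\rho_\nu(\mathcal P_m(X_{L_t}),\mathcal P_n(X_{L_s}))\asymp c_\nu(n,m)\,\eta_t(\lambda_m)(\lambda_m\mathbb E[L_s]+1),$$ $$\rho_\nu(\mathcal P_m(X_{L_t}),\mathcal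 V_n(X_{L_s}))\asymp\kappa_\nu^{-1}(m)\delta_{mn}\,\eta_t(\lambda_m)(\lambda_m\mathbb E[L_s]+1),$$ where $f\asymp g$ means that for some constant $C>0$, $\frac1C g(t)\le f(t)\le Cg(t)$ for all $t\ge t_0$. 4. If $t\mapsto\eta_t(\lambda_m)$ is long-tailed, i.e. $\eta_{t+y}(\lambda_m)/\eta_t(\lambda_m)\to1$ as $t\to\infty$ for every $y>0$, then for every $s>0$, as $t\to\infty$, $$\rho_\nu(\mathcal P_m(X_{L_t}),\mathcal P_n(X_{L_s}))\sim c_\nu(n,m)\,\eta_t(\lambda_m)(\lambda_m\mathbb E[L_s]+1),$$ $$\rho_\nu(\mathcal P_m(X_{L_t}),\mathcal V_n(X_{L_s}))\sim\kappa_\nu^{-1}(m)\delta_{mn}\,\eta_t(\lambda_m)(\lambda_m\mathbb E[L_s]+1),$$ where $f\sim g$ means $f/g\to1$, or, if $g$ is identically $0$, that $f$ is eventually $0$. -/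

import Mathlib

open MeasureTheory ProbabilityTheory Filter Set
open scoped NNReal ENNReal Topology

noncomputable section

namespace SpectralCorrelation

/-! ### Markov semigroups and their extension to `L²(ν)` -/

/-- A transition semigroup `(P_t)_{t ≥ 0}` of Markov (probability) kernels on `E`. -/
structure TransitionSemigroup (E : Type*) [MeasurableSpace E] where
  /-- the transition kernel `P_t(x, dy)` -/
  kernel : ℝ≥0 → Kernel E E
  markov : ∀ t, IsMarkovKernel (kernel t)
  zero : kernel 0 = Kernel.id
  add : ∀ s t, kernel (s + t) = kernel t ∘ₖ kernel s

section L2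

variable {E : Type*} [MeasurableSpace E]

/-- Jensen's inequality and invariance, for the square norms. -/
lemma lintegral_sq_kernel_le (κ : Kernel E E) [IsMarkovKernel κ] (ν : Measure E)
    (hκ : Kernel.Invariant κ ν) {f : E → ℝ} (hf : StronglyMeasurable f) :
    eLpNorm (fun x => ∫ y, f y ∂(κ x)) 2 ν ≤ eLpNorm f 2 ν := by
  have key : ∀ (μ : Measure E) (g : E → ℝ), eLpNorm g 2 μ ^ 2 = ∫⁻ x, ‖g x‖ₑ ^ 2 ∂μ := by
    intro μ g
    have h := eLpNorm_nnreal_pow_eq_lintegral (μ := μ) (f := g) (p := 2) (by norm_num)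
    simpa using h
  have h2 : eLpNorm (fun x => ∫ y, f y ∂(κ x)) 2 ν ^ 2 ≤ eLpNorm f 2 ν ^ 2 := by
    rw [key, key]
    calc ∫⁻ x, ‖∫ y, f y ∂(κ x)‖ₑ ^ 2 ∂ν
        ≤ ∫⁻ x, ∫⁻ y, ‖f y‖ₑ ^ 2 ∂(κ x) ∂ν := by
          refine lintegral_mono fun x => ?_
          rw [← key (κ x) f]
          gcongr
          calc ‖∫ y, f y ∂(κ x)‖ₑ ≤ ∫⁻ y, ‖f y‖ₑ ∂(κ x) := enorm_integral_le_lintegral_enorm _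
            _ = eLpNorm f 1 (κ x) := eLpNorm_one_eq_lintegral_enorm.symm
            _ ≤ eLpNorm f 2 (κ x) :=
              eLpNorm_le_eLpNorm_of_exponent_le (by norm_num) hf.aestronglyMeasurable
      _ = ∫⁻ y, ‖f y‖ₑ ^ 2 ∂(ν.bind κ) :=
          (Measure.lintegral_bind (Kernel.aemeasurable _) (by fun_prop)).symm
      _ = ∫⁻ y, ‖f y‖ₑ ^ 2 ∂ν := by rw [hκ.def]
  exact (ENNReal.pow_le_pow_left_iff (two_ne_zero)).1 h2

lemma memLp_kernel (κ : Kernel E E) [IsMarkovKernel κ] (ν : Measure E)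
    (hκ : Kernel.Invariant κ ν) (f : Lp ℝ 2 ν) :
    MemLp (fun x => ∫ y, f y ∂(κ x)) 2 ν :=
  ⟨(Lp.stronglyMeasurable f).integral_kernel.aestronglyMeasurable,
    (lintegral_sq_kernel_le κ ν hκ (Lp.stronglyMeasurable f)).trans_lt (Lp.memLp f).2⟩

lemma ae_integrable_kernel (κ : Kernel E E) [IsMarkovKernel κ] (ν : Measure E)
    [IsFiniteMeasure ν] (hκ : Kernel.Invariant κ ν) (f : Lp ℝ 2 ν) :
    ∀ᵐ x ∂ν, Integrable f (κ x) := by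
  have hf := Lp.stronglyMeasurable f
  have h1 : ∫⁻ x, ∫⁻ y, ‖f y‖ₑ ∂(κ x) ∂ν < ∞ := by
    rw [← Measure.lintegral_bind (Kernel.aemeasurable _) (by fun_prop), hκ.def]
    exact ((Lp.memLp f).integrable (by norm_num)).2
  have hm : Measurable fun x => ∫⁻ y, ‖f y‖ₑ ∂(κ x) := hf.enorm.lintegral_kernel
  filter_upwards [ae_lt_top hm h1.ne] with x hx
  exact ⟨hf.aestronglyMeasurable, hx⟩

/-- The operator `f ↦ (x ↦ ∫ f(y) κ(x, dy))` on `L²(ν)`, for a Markov kernel `κ` that leaves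
`ν` invariant. -/
def l2Operator (κ : Kernel E E) [IsMarkovKernel κ] (ν : Measure E) [IsFiniteMeasure ν]
    (hκ : Kernel.Invariant κ ν) : Lp ℝ 2 ν →L[ℝ] Lp ℝ 2 ν :=
  LinearMap.mkContinuous
    { toFun := fun f => (memLp_kernel κ ν hκ f).toLp _
      map_add' := by
        intro f g
        rw [← MemLp.toLp_add, MemLp.toLp_eq_toLp_iff]
        have h : ∀ᵐ y ∂(ν.bind κ), (f + g : Lp ℝ 2 ν) y = f y + g y := by
          rw [hκ.def]; exact Lp.coeFn_add f g
        filter_upwards [Measure.ae_ae_of_ae_comp h, ae_integrable_kernel κ ν hκ f,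
          ae_integrable_kernel κ ν hκ g] with x hx hf hg
        rw [integral_congr_ae hx, integral_add hf hg]
        rfl
      map_smul' := by
        intro c f
        rw [RingHom.id_apply, ← MemLp.toLp_const_smul, MemLp.toLp_eq_toLp_iff]
        have h : ∀ᵐ y ∂(ν.bind κ), (c • f : Lp ℝ 2 ν) y = c • f y := by
          rw [hκ.def]; exact Lp.coeFn_smul c f
        filter_upwards [Measure.ae_ae_of_ae_comp h] with x hx
        rw [integral_congr_ae hx, integral_smul]
        rfl }
    1 (by
      intro f
      rw [one_mul]
      change ‖(memLp_kernel κ ν hκ f).toLp _‖ ≤ ‖f‖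
      rw [Lp.norm_toLp, Lp.norm_def]
      exact ENNReal.toReal_mono (Lp.eLpNorm_ne_top f)
        (lintegral_sq_kernel_le κ ν hκ (Lp.stronglyMeasurable f)))

/-- `ν` is an invariant measure of the semigroup: `ν P_t = ν` for every `t ≥ 0`. -/
def TransitionSemigroup.IsInvariant (Q : TransitionSemigroup E) (ν : Measure E) : Prop :=
  ∀ t, Kernel.Invariant (Q.kernel t) ν

/-- The operator `P_t` on `L²(ν)`. -/
def TransitionSemigroup.l2 (Q : TransitionSemigroup E) (ν : Measure E) [IsFiniteMeasure ν]
    (hν : Q.IsInvariant ν) (t : ℝ≥0) : Lp ℝ 2 ν →L[ℝ] Lp ℝ 2 ν :=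
  haveI := Q.markov t
  l2Operator (Q.kernel t) ν (hν t)

/-- `(𝒫_n)` and `(𝒱_n)`, `n ∈ N`, are eigenfunctions in `L²(ν)` of `P_t` and of its adjoint
`P_t^*` for the eigenvalues `e^{-λ_n t}`, with distinct `λ_n ≥ 0`, normalized by
`⟨𝒫_n, 𝒱_n⟩_ν = 1`. -/
structure IsEigenSystem (Q : TransitionSemigroup E) (ν : Measure E) [IsFiniteMeasure ν]
    (hν : Q.IsInvariant ν) (N : Set ℕ) (lam : N → ℝ) (p v : N → Lp ℝ 2 ν) : Prop where
  nonneg : ∀ n, 0 ≤ lam n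
  distinct : Function.Injective lam
  eigen : ∀ n t, Q.l2 ν hν t (p n) = Real.exp (-lam n * t) • p n
  coeigen : ∀ n t,
    ContinuousLinearMap.adjoint (Q.l2 ν hν t) (v n) = Real.exp (-lam n * t) • v n
  normalized : ∀ n, inner ℝ (p n) (v n) = 1

/-- `c_ν(n, m) = ⟨𝒫_n, 𝒫_m⟩_ν / (‖𝒫_n‖_ν ‖𝒫_m‖_ν)`. -/
def cosAngle {ν : Measure E} (f g : Lp ℝ 2 ν) : ℝ := inner ℝ f g / (‖f‖ * ‖g‖)

/-- The condition number `κ_ν(m) = ‖𝒫_m‖_ν ‖𝒱_m‖_ν`. -/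
def condNumber {ν : Measure E} (f g : Lp ℝ 2 ν) : ℝ := ‖f‖ * ‖g‖

end L2

section Processes

variable {Ω : Type*} [mΩ : MeasurableSpace Ω]

/-! ### Markov processes -/

/-- Under `P`, the process `X` is a Markov process with respect to the filtration `ℱ`, with
transition semigroup `Q` and initial law `ν`; so `P` plays the role of `ℙ_ν`. -/
structure IsMarkovProcess {E : Type*} [MeasurableSpace E] (X : ℝ≥0 → Ω → E)
    (ℱ : Filtration ℝ≥0 mΩ) (Q : TransitionSemigroup E) (ν : Measure E) (P : Measure Ω) :
    Prop where
  adapted : ∀ t, Measurable[ℱ t] (X t)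
  initial : P.map (X 0) = ν
  markov : ∀ (s t : ℝ≥0) (f : E → ℝ), Measurable f → (∃ M, ∀ x, |f x| ≤ M) →
    P[fun ω => f (X (s + t) ω) | ℱ s] =ᵐ[P] fun ω => ∫ y, f y ∂(Q.kernel t (X s ω))

/-! ### Subordinators, their inverses and renewal measures -/

/-- A subordinator: a real-valued Lévy process whose paths are (almost surely) non-decreasing
and right-continuous. -/
structure IsSubordinator (T : ℝ≥0 → Ω → ℝ) (P : Measure Ω) : Prop where
  measurable : ∀ t, Measurable (T t)
  zero : ∀ᵐ ω ∂P, T 0 ω = 0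
  indep : HasIndepIncrements T P
  stationary : ∀ s t, P.map (fun ω => T (s + t) ω - T s ω) = P.map (T t)
  mono : ∀ᵐ ω ∂P, Monotone fun t => T t ω
  rightCont : ∀ᵐ ω ∂P, ∀ t, ContinuousWithinAt (fun u => T u ω) (Ici t) t

/-- `L_t = inf {s > 0 : T_s > t}`, with value `∞` if there is no such `s`. -/
def inverseTop (T : ℝ≥0 → Ω → ℝ) (t : ℝ) (ω : Ω) : ℝ≥0∞ :=
  ⨅ (s : ℝ≥0) (_ : 0 < s ∧ t < T s ω), (s : ℝ≥0∞)

/-- `L_t` as a finite number; used only when `L_t < ∞` almost surely. -/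
def inverse (T : ℝ≥0 → Ω → ℝ) (t : ℝ) (ω : Ω) : ℝ≥0 := (inverseTop T t ω).toNNReal

/-- `η_t(λ) = ∫ e^{-λ u} l_t(du)`, where `l_t` is the law of `L_t`. -/
def eta (P : Measure Ω) (T : ℝ≥0 → Ω → ℝ) (t l : ℝ) : ℝ :=
  ∫ u : ℝ≥0, Real.exp (-l * u) ∂(P.map (inverse T t))

/-- The renewal measure `U(dr) = ∫_0^∞ ℙ(T_v ∈ dr) dv`. -/
def renewalMeasure (P : Measure Ω) (T : ℝ≥0 → Ω → ℝ) : Measure ℝ :=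
  (volume.restrict (Ici (0 : ℝ))).bind fun v => P.map (T v.toNNReal)

/-- `X` is a measurable process, and is independent of the process `T`: for some σ-algebra `𝒢`
independent of `σ(T_t : t ≥ 0)`, the map `(u, ω) ↦ X_u(ω)` is measurable for `ℬ(ℝ₊) ⊗ 𝒢`.
For `X` with right-continuous paths in a metric space one can take `𝒢 = σ(X_u : u ≥ 0)`. -/
def IsMeasurableIndep {E : Type*} [MeasurableSpace E] (X : ℝ≥0 → Ω → E) (T : ℝ≥0 → Ω → ℝ)
    (P : Measure Ω) : Prop :=
  ∃ 𝒢 : MeasurableSpace Ω, 𝒢 ≤ mΩ ∧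
    Measurable[(inferInstance : MeasurableSpace ℝ≥0).prod 𝒢] (fun q : ℝ≥0 × Ω => X q.1 q.2) ∧
    Indep 𝒢 (⨆ t : ℝ≥0, MeasurableSpace.comap (T t) inferInstance) P

/-- The time-changed process `X_{L_t}`. -/
def timeChange {E : Type*} (X : ℝ≥0 → Ω → E) (T : ℝ≥0 → Ω → ℝ) (t : ℝ) (ω : Ω) : E :=
  X (inverse T t ω) ω

/-! ### Covariance and correlation -/

/-- `𝔼[Y Z] - 𝔼[Y] 𝔼[Z]`. -/
def covar (P : Measure Ω) (Y Z : Ω → ℝ) : ℝ :=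
  (∫ ω, Y ω * Z ω ∂P) - (∫ ω, Y ω ∂P) * ∫ ω, Z ω ∂P

/-- The standard deviation. -/
def std (P : Measure Ω) (Y : Ω → ℝ) : ℝ := Real.sqrt (covar P Y Y)

open Classical in
/-- The correlation, with value `0` if one of the standard deviations vanishes. -/
def corr (P : Measure Ω) (Y Z : Ω → ℝ) : ℝ :=
  if 0 < std P Y * std P Z then covar P Y Z / (std P Y * std P Z) else 0

/-- `ρ_ν(f(X_{L_t}), g(X_{L_s}))`. -/
def corrL {E : Type*} [MeasurableSpace E] {ν : Measure E} (P : Measure Ω) (X : ℝ≥0 → Ω → E)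
    (T : ℝ≥0 → Ω → ℝ) (f g : Lp ℝ 2 ν) (t s : ℝ) : ℝ :=
  corr P (fun ω => f (timeChange X T t ω)) (fun ω => g (timeChange X T s ω))

end Processes

/-! ### Comparison of functions -/

/-- `f ≍ g` on `[a, ∞)`: for some constant `C > 0`, `g(x)/C ≤ f(x) ≤ C g(x)` for all `x ≥ a`. -/
def ComparableFrom (a : ℝ) (f g : ℝ → ℝ) : Prop :=
  ∃ C : ℝ, 0 < C ∧ ∀ x, a ≤ x → 1 / C * g x ≤ f x ∧ f x ≤ C * g x

/-- Long-tailed functions: `f(x + y) / f(x) → 1` as `x → ∞`, for every `y > 0`. -/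
def LongTailed (f : ℝ → ℝ) : Prop :=
  ∀ y : ℝ, 0 < y → Tendsto (fun x => f (x + y) / f x) atTop (𝓝 1)

end SpectralCorrelation

end

/-! Everything reduces to one Laplace transform. For fixed times a ≤ b, the Markov property and
invariance give 𝔼[f(X_b) g(X_a)] = ⟨P_{b-a} f, g⟩, which is e^{-λ(b-a)} ⟨f, g⟩ for an eigenfunction
f. Since X is independent of T, one may put b = L_t and a = L_s and average
(`integral_timeChange_mul`). The law of X_{L_t} is still ν, and eigenfunctions with λ > 0 have mean
zero. Hence the correlation is the cosine of the angle between f and g times 𝔼[e^{-λ(L_t - L_s)}];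
for the pair 𝒫_m, 𝒱_n biorthogonality supplies the δ_{mn}.

To compute this mean, `lintegral_exp_initial` expands e^{-λ(b-a)} = e^{-λb} + λ ∫_0^a e^{-λ(b-u)}
du. With a = L_s, the condition u < L_s is almost surely T_u ≤ s for all but countably many u. There
the Markov property of T at time u (`lintegral_exp_inverse_sub`) replaces L_t - u by an inverse at
level t - T_u, whose transform is η_{t-r} at r = T_u. Integrating over u produces the renewal
measure (`lintegral_exp_inverse_sub_inverse`).

The bounds follow from η_t ≤ η_{t-r} ≤ η_{t-s} for 0 ≤ r ≤ s and U([0,s]) = 𝔼[L_s]; the asymptotic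
claims follow from the bounds. -/

namespace SpectralCorrelation

/-! ### Pathwise properties of the inverse -/

section Inverse

variable {Ω : Type*} {T : ℝ≥0 → Ω → ℝ} {t s : ℝ} {ω : Ω}

/-- The inverse of `T`, computed from the values of `T` at rational times. -/
noncomputable def inverseRat (T : ℝ≥0 → Ω → ℝ) (t : ℝ) (ω : Ω) : ℝ≥0∞ :=
  open Classical in
  ⨅ q : ℚ, if 0 < (q : ℝ).toNNReal ∧ t < T (q : ℝ).toNNReal ω
    then ((q : ℝ).toNNReal : ℝ≥0∞) else ∞

lemma measurable_inverseRat [MeasurableSpace Ω] (h : ∀ u, Measurable (T u)) (t : ℝ) :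
    Measurable (inverseRat T t) := by
  classical
  refine Measurable.iInf fun q => Measurable.ite ?_ measurable_const measurable_const
  exact (MeasurableSet.const _).inter (measurableSet_lt measurable_const (h _))

/-- On a monotone path an admissible u may be replaced by any larger rational. The countable infimum
is what makes L_t measurable up to a null set. -/
lemma inverseTop_eq_inverseRat (h : Monotone fun u => T u ω) (t : ℝ) :
    inverseTop T t ω = inverseRat T t ω := by
  classical
  refine le_antisymm (le_iInf fun q => ?_) (le_iInf₂ fun u hu => ?_)
  · split_ifs with hq
    · exact iInf₂_le (f := fun (u : ℝ≥0) (_ : 0 < u ∧ t < T u ω) => (u : ℝ≥0∞)) _ hq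
    · exact le_top
  · refine le_of_forall_gt fun c hc => ?_
    obtain ⟨q, -, h1, h2⟩ := ENNReal.lt_iff_exists_rat_btwn.1 hc
    have h1' : u < (q : ℝ).toNNReal := by exact_mod_cast h1
    refine lt_of_le_of_lt (iInf_le _ q) ?_
    rwa [if_pos ⟨hu.1.trans h1', hu.2.trans_le (h h1'.le)⟩]

lemma inverseTop_mono (hst : s ≤ t) : inverseTop T s ω ≤ inverseTop T t ω :=
  le_iInf₂ fun u hu => iInf₂_le u ⟨hu.1, hst.trans_lt hu.2⟩

lemma inverse_mono (hst : s ≤ t) (ht : inverseTop T t ω < ∞) :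
    inverse T s ω ≤ inverse T t ω :=
  ENNReal.toNNReal_mono ht.ne (inverseTop_mono hst)

/-- This and `le_inverse_of_le` are the two halves of u < L_t ⟺ T_u ≤ t; they leave only the case u
= L_t undecided. -/
lemma le_of_lt_inverse (ht : inverseTop T t ω < ∞) {u : ℝ≥0} (hu : 0 < u)
    (h : u < inverse T t ω) : T u ω ≤ t := by
  by_contra! hlt
  have h1 : inverseTop T t ω ≤ u := iInf₂_le u ⟨hu, hlt⟩
  rw [← ENNReal.coe_toNNReal ht.ne] at h1
  exact absurd (ENNReal.coe_le_coe.1 h1) (not_le.2 h)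

lemma le_inverse_of_le (hmono : Monotone fun u => T u ω) (ht : inverseTop T t ω < ∞)
    {u : ℝ≥0} (h : T u ω ≤ t) : u ≤ inverse T t ω := by
  have h1 : (u : ℝ≥0∞) ≤ inverseTop T t ω := by
    refine le_iInf₂ fun w hw => ?_
    have : ¬ w ≤ u := fun hwu => absurd (hw.2.trans_le (hmono hwu)) (not_lt.2 h)
    exact_mod_cast (not_le.1 this).le
  rw [← ENNReal.coe_toNNReal ht.ne] at h1
  exact_mod_cast h1

end Inverse

/-! ### Exponential integrals and Laplace transforms -/

section Exponential

lemma lintegral_exp_tail {l : ℝ} (hl : 0 < l) (c : ℝ≥0) :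
    ∫⁻ u in Ici (0 : ℝ), ({u : ℝ | (c : ℝ) ≤ u}.indicator
        fun u => ENNReal.ofReal (l * Real.exp (-l * u))) u
      = ENNReal.ofReal (Real.exp (-l * c)) := by
  rw [setLIntegral_indicator (show MeasurableSet {u : ℝ | (c : ℝ) ≤ u} from measurableSet_Ici)]
  have h1 : {u : ℝ | (c : ℝ) ≤ u} ∩ Ici 0 = Ici (c : ℝ) := by
    ext u; simp only [mem_inter_iff, mem_ofPred_eq, mem_Ici]
    exact ⟨fun h => h.1, fun h => ⟨h, c.2.trans h⟩⟩
  have h2 : IntegrableOn (fun u : ℝ => l * Real.exp (-l * u)) (Ioi (c : ℝ)) :=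
    (integrableOn_exp_mul_Ioi (by linarith) _).const_mul l
  rw [h1, setLIntegral_congr Ioi_ae_eq_Ici.symm, ← ofReal_integral_eq_lintegral_ofReal h2
    (Eventually.of_forall fun u => by positivity), integral_const_mul,
    integral_exp_mul_Ioi (by linarith)]
  congr 1
  field_simp

/-- The fundamental theorem of calculus for u ↦ e^{-l(b-u)} on [0, a]. The indicator form with
values in `ℝ≥0∞` allows Tonelli once a and b become random. -/
lemma lintegral_exp_initial {l : ℝ} (hl : 0 < l) (a b : ℝ≥0) :
    ENNReal.ofReal (Real.exp (-l * b)) + ENNReal.ofReal l *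
      ∫⁻ u in Ici (0 : ℝ), ({u : ℝ | u < (a : ℝ)}.indicator
        fun u => ENNReal.ofReal (Real.exp (-l * (b - u)))) u
      = ENNReal.ofReal (Real.exp (-l * (b - a))) := by
  rw [setLIntegral_indicator (show MeasurableSet {u : ℝ | u < (a : ℝ)} from measurableSet_Iio)]
  have h1 : {u : ℝ | u < (a : ℝ)} ∩ Ici 0 = Ico 0 (a : ℝ) := by
    ext u; simp [and_comm]
  have h0 : Continuous fun u : ℝ => Real.exp (-l * (b - u)) := by fun_prop
  have h2 : IntegrableOn (fun u : ℝ => Real.exp (-l * (b - u))) (Ioc 0 (a : ℝ)) :=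
    (h0.integrableOn_Icc).mono_set Ioc_subset_Icc_self
  have h3 : ∫ u in (0 : ℝ)..a, Real.exp (-l * (b - u))
      = Real.exp (-l * (b - a)) / l - Real.exp (-l * b) / l := by
    rw [intervalIntegral.integral_eq_sub_of_hasDerivAt
      (f := fun u => Real.exp (-l * (b - u)) / l) (fun u _ => ?_) (h0.intervalIntegrable _ _)]
    · simp
    · have : HasDerivAt (fun u : ℝ => -l * (b - u)) l u := by
        simpa using ((hasDerivAt_id u).const_sub (b : ℝ)).const_mul (-l)
      have h := this.exp.div_const l
      rwa [mul_div_assoc, div_self hl.ne', mul_one] at h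
  rw [h1, setLIntegral_congr Ico_ae_eq_Ioc, ← ofReal_integral_eq_lintegral_ofReal h2
    (Eventually.of_forall fun u => by positivity),
    ← intervalIntegral.integral_of_le (NNReal.coe_nonneg a), h3,
    ← ENNReal.ofReal_mul hl.le, ← ENNReal.ofReal_add (by positivity)]
  · congr 1; field_simp; ring
  · rw [← sub_div, mul_div_cancel₀ _ hl.ne', sub_nonneg, Real.exp_le_exp]
    nlinarith [a.2]

/-- The Laplace transform of a non-negative random variable, as an integral of its
distribution function. -/
lemma lintegral_exp_eq_lintegral_measure_le {Ω : Type*} [MeasurableSpace Ω] {μ : Measure Ω}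
    [SFinite μ] {Y : Ω → ℝ≥0} (hY : AEMeasurable Y μ) {l : ℝ} (hl : 0 < l) :
    ∫⁻ ω, ENNReal.ofReal (Real.exp (-l * Y ω)) ∂μ =
      ∫⁻ u in Ici (0 : ℝ), ENNReal.ofReal (l * Real.exp (-l * u)) * μ {ω | (Y ω : ℝ) ≤ u} := by
  wlog hm : Measurable Y generalizing Y
  · obtain ⟨Z, hZ, hYZ⟩ := hY
    rw [show ∫⁻ ω, ENNReal.ofReal (Real.exp (-l * Y ω)) ∂μ =
      ∫⁻ ω, ENNReal.ofReal (Real.exp (-l * Z ω)) ∂μ from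
        lintegral_congr_ae (hYZ.mono fun ω hω => by simp only [hω]), this hZ.aemeasurable hZ]
    refine lintegral_congr fun u => ?_
    congr 1
    refine measure_congr (hYZ.mono fun ω hω => ?_)
    change ((Z ω : ℝ) ≤ u) = ((Y ω : ℝ) ≤ u)
    rw [hω]
  simp_rw [← lintegral_exp_tail hl]
  rw [lintegral_lintegral_swap]
  · refine lintegral_congr fun u => ?_
    have hs : MeasurableSet {ω | (Y ω : ℝ) ≤ u} :=
      measurableSet_le (by fun_prop) measurable_const
    rw [← lintegral_indicator_const hs]
    rfl
  · refine Measurable.aemeasurable ?_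
    have : MeasurableSet {q : Ω × ℝ | (Y q.1 : ℝ) ≤ q.2} :=
      measurableSet_le (by fun_prop) (by fun_prop)
    exact Measurable.indicator (f := fun q : Ω × ℝ => ENNReal.ofReal (l * Real.exp (-l * q.2)))
      (by fun_prop) this

end Exponential

/-! ### The subordinator, its inverse and the renewal measure -/

section Subordinator

variable {Ω : Type*} [mΩ : MeasurableSpace Ω] {P : Measure Ω} {T : ℝ≥0 → Ω → ℝ} {s t l : ℝ}

lemma ae_inverseTop_lt_top (hL : ∀ t : ℝ, 0 ≤ t → ∀ᵐ ω ∂P, inverseTop T t ω < ∞) (t : ℝ) :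
    ∀ᵐ ω ∂P, inverseTop T t ω < ∞ :=
  (hL (max t 0) (le_max_right _ _)).mono fun _ h => (inverseTop_mono (le_max_left _ _)).trans_lt h

lemma IsSubordinator.inverse_ae_eq (hT : IsSubordinator T P) (t : ℝ) :
    inverse T t =ᵐ[P] fun ω => (inverseRat T t ω).toNNReal :=
  hT.mono.mono fun ω h => by rw [inverse, inverseTop_eq_inverseRat h]

lemma IsSubordinator.aemeasurable_inverse (hT : IsSubordinator T P) (t : ℝ) :
    AEMeasurable (inverse T t) P :=
  ⟨_, (measurable_inverseRat hT.measurable t).ennreal_toNNReal, hT.inverse_ae_eq t⟩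

lemma IsSubordinator.ae_nonneg (hT : IsSubordinator T P) (u : ℝ≥0) : ∀ᵐ ω ∂P, 0 ≤ T u ω := by
  filter_upwards [hT.zero, hT.mono] with ω h0 hm
  exact h0 ▸ hm zero_le

/-- Apart from countably many `u`, the events `T_u ≤ t` and `u < L_t` agree almost surely. -/
lemma IsSubordinator.exists_countable [IsProbabilityMeasure P] (hT : IsSubordinator T P)
    (hL : ∀ t : ℝ, 0 ≤ t → ∀ᵐ ω ∂P, inverseTop T t ω < ∞) (t : ℝ) :
    ∃ C : Set ℝ, C.Countable ∧ ∀ u : ℝ, 0 < u → u ∉ C →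
      ∀ᵐ ω ∂P, (T u.toNNReal ω ≤ t ↔ u < inverse T t ω) := by
  set Y : Ω → ℝ := fun ω => ((inverseRat T t ω).toNNReal : ℝ) with hYdef
  have hY : Measurable Y := by
    have := (measurable_inverseRat hT.measurable t).ennreal_toNNReal
    fun_prop
  -- The exceptional set consists of the atoms of the law of L_t, at most countable in number.
  refine ⟨{u | 0 < P {ω | Y ω = u}}, Measure.countable_meas_level_set_pos hY, fun u hu huC => ?_⟩
  have hne : ∀ᵐ ω ∂P, Y ω ≠ u := by
    have : P {ω | Y ω = u} = 0 := by simpa using huC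
    rw [ae_iff]; simpa using this
  filter_upwards [hne, hT.mono, ae_inverseTop_lt_top hL t] with ω hne hm hfin
  have hYω : Y ω = inverse T t ω := by simp only [hYdef, inverse, inverseTop_eq_inverseRat hm]
  have hu' : (u.toNNReal : ℝ) = u := Real.coe_toNNReal u hu.le
  constructor
  · intro h
    have h1 := le_inverse_of_le hm hfin h
    have h2 : u ≤ inverse T t ω := by rw [← hu']; exact_mod_cast h1
    exact lt_of_le_of_ne h2 (by rw [← hYω]; exact hne.symm)
  · intro h
    refine le_of_lt_inverse hfin (by simpa using hu) ?_
    rw [← hu'] at h; exact_mod_cast h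

lemma ae_restrict_Ici_pos_notMem {C : Set ℝ} (hC : C.Countable) :
    ∀ᵐ u ∂(volume.restrict (Ici (0 : ℝ))), 0 < u ∧ u ∉ C := by
  have h1 : ∀ᵐ u ∂(volume.restrict (Ici (0 : ℝ))), 0 ≤ u := ae_restrict_mem measurableSet_Ici
  have h2 : ∀ᵐ u ∂(volume.restrict (Ici (0 : ℝ))), u ∉ C :=
    ae_restrict_of_ae (hC.ae_notMem volume)
  have h3 : ∀ᵐ u ∂(volume.restrict (Ici (0 : ℝ))), u ∉ ({0} : Set ℝ) :=
    ae_restrict_of_ae ((countable_singleton 0).ae_notMem volume)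
  filter_upwards [h1, h2, h3] with u h1 h2 h3
  exact ⟨lt_of_le_of_ne h1 (by simpa [eq_comm] using h3), h2⟩

lemma eta_eq [IsProbabilityMeasure P] (hT : IsSubordinator T P) (t l : ℝ) :
    eta P T t l = ∫ ω, Real.exp (-l * inverse T t ω) ∂P :=
  integral_map (hT.aemeasurable_inverse t)
    (by fun_prop : Measurable fun u : ℝ≥0 => Real.exp (-l * u)).aestronglyMeasurable

lemma integrable_exp_inverse [IsProbabilityMeasure P] (hT : IsSubordinator T P) (hl : 0 < l)
    (t : ℝ) : Integrable (fun ω => Real.exp (-l * inverse T t ω)) P := by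
  have hm : Measurable fun u : ℝ≥0 => Real.exp (-l * u) := by fun_prop
  refine Integrable.of_bound (C := 1)
    (hm.comp_aemeasurable (hT.aemeasurable_inverse t)).aestronglyMeasurable
      (Eventually.of_forall fun ω => ?_)
  simp only [neg_mul, Real.norm_eq_abs, Real.abs_exp, Real.exp_le_one_iff, Left.neg_nonpos_iff]
  positivity

lemma ofReal_eta [IsProbabilityMeasure P] (hT : IsSubordinator T P) (hl : 0 < l) (t : ℝ) :
    ENNReal.ofReal (eta P T t l) =
      ∫⁻ ω, ENNReal.ofReal (Real.exp (-l * inverse T t ω)) ∂P := by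
  rw [eta_eq hT, ofReal_integral_eq_lintegral_ofReal (integrable_exp_inverse hT hl t)
    (Eventually.of_forall fun ω => (Real.exp_pos _).le)]

/-- Each u ↦ ℙ(T_u ≤ x) is antitone because paths increase, and half-lines form a generating
π-system. -/
lemma IsSubordinator.measurable_law [IsProbabilityMeasure P] (hT : IsSubordinator T P) :
    Measurable fun u : ℝ => P.map (T u.toNNReal) := by
  have : ∀ u : ℝ, IsProbabilityMeasure (P.map (T u.toNNReal)) := fun u =>
    Measure.isProbabilityMeasure_map (hT.measurable _).aemeasurable
  refine .measure_of_isPiSystem_of_isProbabilityMeasure (borel_eq_generateFrom_Iic ℝ)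
    isPiSystem_Iic ?_
  rintro _ ⟨x, rfl⟩
  refine Antitone.measurable fun u w huw => ?_
  rw [Measure.map_apply (hT.measurable _) measurableSet_Iic,
    Measure.map_apply (hT.measurable _) measurableSet_Iic]
  refine measure_mono_ae (hT.mono.mono fun ω hm h => ?_)
  exact (hm (Real.toNNReal_le_toNNReal huw)).trans h

/-- `η_t(l)` in terms of the one-dimensional distributions of the subordinator. -/
lemma ofReal_eta_eq_lintegral [IsProbabilityMeasure P] (hT : IsSubordinator T P)
    (hL : ∀ t : ℝ, 0 ≤ t → ∀ᵐ ω ∂P, inverseTop T t ω < ∞) (hl : 0 < l) (t : ℝ) :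
    ENNReal.ofReal (eta P T t l) = ∫⁻ u in Ici (0 : ℝ),
      ENNReal.ofReal (l * Real.exp (-l * u)) * P.map (T u.toNNReal) (Ioi t) := by
  rw [ofReal_eta hT hl, lintegral_exp_eq_lintegral_measure_le (hT.aemeasurable_inverse t) hl]
  obtain ⟨C, hC, h⟩ := hT.exists_countable hL t
  refine lintegral_congr_ae ((ae_restrict_Ici_pos_notMem hC).mono fun u hu => ?_)
  dsimp only
  rw [Measure.map_apply (hT.measurable _) measurableSet_Ioi]
  congr 1
  refine measure_congr ((h u hu.1 hu.2).mono fun ω hω => ?_)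
  change ((inverse T t ω : ℝ) ≤ u) = (t < T u.toNNReal ω)
  rw [eq_iff_iff, ← not_lt, ← hω, not_le]

/-- The joint law of `T_v` and `T_{v+u}`. -/
lemma IsSubordinator.measure_le_inter_gt [IsProbabilityMeasure P] (hT : IsSubordinator T P)
    (s t : ℝ) (v u : ℝ≥0) :
    P ({ω | t < T (v + u) ω} ∩ {ω | T v ω ≤ s}) =
      ∫⁻ r in Iic s, P.map (T u) (Ioi (t - r)) ∂(P.map (T v)) := by
  -- Given T_v = r, the event T_{v+u} > t says that the increment, independent of T_v and
  -- distributed as T_u, exceeds t - r.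
  have hind := hT.indep.indepFun_eval_sub (zero_le : 0 ≤ v)
    (le_add_of_nonneg_right (zero_le : 0 ≤ u)) hT.zero
  have hm := hT.measurable
  have hlaw := hind.map_prod_eq_prod_map_map (hm v).aemeasurable
    ((hm (v + u)).sub (hm v)).aemeasurable
  have hA : MeasurableSet {q : ℝ × ℝ | q.1 ≤ s ∧ t - q.1 < q.2} :=
    (measurableSet_le measurable_fst measurable_const).inter
      (measurableSet_lt (measurable_const.sub measurable_fst) measurable_snd)
  have h1 := congrArg (fun μ => μ {q : ℝ × ℝ | q.1 ≤ s ∧ t - q.1 < q.2}) hlaw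
  have hst : P.map (T (v + u) - T v) = P.map (T u) := hT.stationary v u
  rw [Measure.map_apply ((hm v).prodMk ((hm (v + u)).sub (hm v))) hA, hst] at h1
  have : IsProbabilityMeasure (P.map (T u)) := Measure.isProbabilityMeasure_map (hm u).aemeasurable
  rw [Measure.prod_apply hA] at h1
  rw [← lintegral_indicator measurableSet_Iic]
  convert h1 using 1
  · congr 1; ext ω
    simp only [mem_inter_iff, mem_ofPred_eq, mem_preimage, Pi.sub_apply, sub_lt_sub_iff_right]
    tauto
  · refine lintegral_congr fun r => ?_
    by_cases hr : r ≤ s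
    · rw [indicator_of_mem (show r ∈ Iic s from hr)]
      congr 1; ext y; simp [hr]
    · rw [indicator_of_notMem (show r ∉ Iic s from hr)]
      simp [hr]

lemma IsSubordinator.measurable_law_Ioi [IsProbabilityMeasure P] (hT : IsSubordinator T P)
    (t : ℝ) : Measurable fun q : ℝ × ℝ => P.map (T q.1.toNNReal) (Ioi (t - q.2)) := by
  let κ : Kernel ℝ ℝ := ⟨fun u => P.map (T u.toNNReal), hT.measurable_law⟩
  have : IsMarkovKernel κ := ⟨fun u =>
    Measure.isProbabilityMeasure_map (hT.measurable _).aemeasurable⟩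
  have hA : MeasurableSet {q : (ℝ × ℝ) × ℝ | t - q.1.2 < q.2} :=
    measurableSet_lt (by fun_prop) (by fun_prop)
  exact Kernel.measurable_kernel_prodMk_left (κ := κ.comap Prod.fst measurable_fst) hA

/-- The Markov property of the subordinator at time `v`. -/
lemma lintegral_exp_inverse_sub [IsProbabilityMeasure P] (hT : IsSubordinator T P)
    (hL : ∀ t : ℝ, 0 ≤ t → ∀ᵐ ω ∂P, inverseTop T t ω < ∞) (hl : 0 < l) (hst : s ≤ t)
    {v : ℝ} (hv : 0 < v) :
    ∫⁻ ω in {ω | T v.toNNReal ω ≤ s}, ENNReal.ofReal (Real.exp (-l * (inverse T t ω - v))) ∂P =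
      ∫⁻ r in Iic s, ENNReal.ofReal (eta P T (t - r) l) ∂(P.map (T v.toNNReal)) := by
  have hA : MeasurableSet {ω | T v.toNNReal ω ≤ s} :=
    measurableSet_le (hT.measurable _) measurable_const
  -- On T_v ≤ s ≤ t one has v ≤ L_t, so the truncated subtraction L_t - v in `ℝ≥0` is the true one
  -- and the Laplace formula applies to it.
  have hle : ∀ᵐ ω ∂P, T v.toNNReal ω ≤ s → v.toNNReal ≤ inverse T t ω := by
    filter_upwards [hT.mono, ae_inverseTop_lt_top hL t] with ω hm hfin h
    exact le_inverse_of_le hm hfin (h.trans hst)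
  have hvv : (v.toNNReal : ℝ) = v := Real.coe_toNNReal v hv.le
  have h1 : ∫⁻ ω in {ω | T v.toNNReal ω ≤ s},
        ENNReal.ofReal (Real.exp (-l * (inverse T t ω - v))) ∂P =
      ∫⁻ ω in {ω | T v.toNNReal ω ≤ s},
        ENNReal.ofReal (Real.exp (-l * (inverse T t ω - v.toNNReal : ℝ≥0))) ∂P := by
    refine setLIntegral_congr_fun_ae hA (hle.mono fun ω h hω => ?_)
    rw [NNReal.coe_sub (h hω), hvv]
  have hmeas : AEMeasurable (fun ω => inverse T t ω - v.toNNReal) P :=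
    (hT.aemeasurable_inverse t).sub aemeasurable_const
  rw [h1, lintegral_exp_eq_lintegral_measure_le hmeas.restrict hl]
  simp_rw [ofReal_eta_eq_lintegral hT hL hl]
  have : IsProbabilityMeasure (P.map (T v.toNNReal)) :=
    Measure.isProbabilityMeasure_map (hT.measurable _).aemeasurable
  rw [lintegral_lintegral_swap]
  swap
  · refine Measurable.aemeasurable ?_
    have := (hT.measurable_law_Ioi t).comp measurable_swap
    exact Measurable.mul (by fun_prop) this
  -- Both sides are now integrals over u. Unless v + u is an atom of L_t, the condition L_t - v ≤ u
  -- means t < T_{v+u}, so both integrands contain ℙ(T_v ≤ s, T_{v+u} > t).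
  obtain ⟨C, hC, h⟩ := hT.exists_countable hL t
  have hC' : ((fun u => v + u) ⁻¹' C).Countable :=
    hC.preimage (add_right_injective v)
  refine lintegral_congr_ae ((ae_restrict_Ici_pos_notMem hC').mono fun u hu => ?_)
  have hu0 : 0 < u := hu.1
  dsimp only
  rw [lintegral_const_mul' _ _ ENNReal.ofReal_ne_top,
    ← hT.measure_le_inter_gt, ← Real.toNNReal_add hv.le hu0.le]
  congr 1
  rw [Measure.restrict_apply' hA]
  refine measure_congr ?_
  filter_upwards [h (v + u) (by linarith) hu.2, hle] with ω hω hle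
  change (((inverse T t ω - v.toNNReal : ℝ≥0) : ℝ) ≤ u ∧ T v.toNNReal ω ≤ s) =
    (t < T (v + u).toNNReal ω ∧ T v.toNNReal ω ≤ s)
  rw [eq_iff_iff]
  refine and_congr_left fun hs => ?_
  rw [NNReal.coe_sub (hle hs), hvv, ← not_le (a := T (v + u).toNNReal ω), hω, not_lt,
    sub_le_iff_le_add']

/-- Since T_v ≥ 0 almost surely, [0, s] may be replaced by (-∞, s] under each law. -/
lemma lintegral_renewalMeasure [IsProbabilityMeasure P] (hT : IsSubordinator T P)
    {f : ℝ → ℝ≥0∞} (hf : Measurable f) (s : ℝ) :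
    ∫⁻ r in Icc 0 s, f r ∂(renewalMeasure P T) =
      ∫⁻ v in Ici (0 : ℝ), ∫⁻ r in Iic s, f r ∂(P.map (T v.toNNReal)) := by
  rw [← lintegral_indicator measurableSet_Icc, renewalMeasure,
    Measure.lintegral_bind hT.measurable_law.aemeasurable
      (hf.indicator measurableSet_Icc).aemeasurable]
  refine lintegral_congr fun v => ?_
  rw [lintegral_indicator measurableSet_Icc]
  refine setLIntegral_congr ?_
  have : ∀ᵐ r ∂(P.map (T v.toNNReal)), 0 ≤ r :=
    (ae_map_iff (hT.measurable _).aemeasurable measurableSet_Ici).2 (hT.ae_nonneg _)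
  filter_upwards [this] with r hr
  change (0 ≤ r ∧ r ≤ s) = (r ≤ s)
  simp [hr]

lemma eta_nonneg (t l : ℝ) : 0 ≤ eta P T t l := integral_nonneg fun _ => (Real.exp_pos _).le

lemma eta_pos [IsProbabilityMeasure P] (hT : IsSubordinator T P) (hl : 0 < l) (t : ℝ) :
    0 < eta P T t l := by
  rw [eta_eq hT]
  exact integral_exp_pos (integrable_exp_inverse hT hl t)

lemma eta_antitone [IsProbabilityMeasure P] (hT : IsSubordinator T P)
    (hL : ∀ t : ℝ, 0 ≤ t → ∀ᵐ ω ∂P, inverseTop T t ω < ∞) (hl : 0 < l) :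
    Antitone fun t => eta P T t l := by
  intro s t hst
  simp only [eta_eq hT]
  refine integral_mono_ae (integrable_exp_inverse hT hl t) (integrable_exp_inverse hT hl s) ?_
  filter_upwards [ae_inverseTop_lt_top hL t] with ω hω
  have : (inverse T s ω : ℝ) ≤ inverse T t ω := by exact_mod_cast inverse_mono hst hω
  exact Real.exp_le_exp.2 (by nlinarith)

/-- The mean of `exp (-l (L_t - L_s))` in terms of the renewal measure. -/
lemma lintegral_exp_inverse_sub_inverse [IsProbabilityMeasure P] (hT : IsSubordinator T P)
    (hL : ∀ t : ℝ, 0 ≤ t → ∀ᵐ ω ∂P, inverseTop T t ω < ∞) (hl : 0 < l) (hst : s ≤ t) :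
    ∫⁻ ω, ENNReal.ofReal (Real.exp (-l * (inverse T t ω - inverse T s ω))) ∂P =
      ENNReal.ofReal (eta P T t l) + ENNReal.ofReal l *
        ∫⁻ r in Icc 0 s, ENNReal.ofReal (eta P T (t - r) l) ∂(renewalMeasure P T) := by
  have hmt := hT.aemeasurable_inverse t
  have hms := hT.aemeasurable_inverse s
  have hη : Measurable fun r => ENNReal.ofReal (eta P T (t - r) l) :=
    ((eta_antitone hT hL hl).measurable.comp (measurable_const.sub measurable_id)).ennreal_ofReal
  have h1 : ∫⁻ ω, ENNReal.ofReal (Real.exp (-l * (inverse T t ω - inverse T s ω))) ∂P =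
      ∫⁻ ω, (ENNReal.ofReal (Real.exp (-l * inverse T t ω)) + ENNReal.ofReal l *
      ∫⁻ u in Ici (0 : ℝ), ({u : ℝ | u < (inverse T s ω : ℝ)}.indicator
        fun u => ENNReal.ofReal (Real.exp (-l * (inverse T t ω - u)))) u) ∂P := by
    exact lintegral_congr fun ω => (lintegral_exp_initial hl _ _).symm
  have hjoint : AEMeasurable (fun q : Ω × ℝ => ({u : ℝ | u < (inverse T s q.1 : ℝ)}.indicator
        fun u => ENNReal.ofReal (Real.exp (-l * (inverse T t q.1 - u)))) q.2)
      (P.prod (volume.restrict (Ici (0 : ℝ)))) := by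
    have ht1 : AEMeasurable (fun q : Ω × ℝ => inverse T t q.1)
        (P.prod (volume.restrict (Ici (0 : ℝ)))) :=
      hmt.comp_quasiMeasurePreserving Measure.quasiMeasurePreserving_fst
    have hs1 : AEMeasurable (fun q : Ω × ℝ => inverse T s q.1)
        (P.prod (volume.restrict (Ici (0 : ℝ)))) :=
      hms.comp_quasiMeasurePreserving Measure.quasiMeasurePreserving_fst
    have hs : NullMeasurableSet {q : Ω × ℝ | q.2 < (inverse T s q.1 : ℝ)}
        (P.prod (volume.restrict (Ici (0 : ℝ)))) :=
      nullMeasurableSet_lt (by fun_prop) (by fun_prop)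
    exact AEMeasurable.indicator₀
      (f := fun q : Ω × ℝ => ENNReal.ofReal (Real.exp (-l * (inverse T t q.1 - q.2))))
      (by fun_prop) hs
  rw [h1, lintegral_add_left' (by fun_prop), ← ofReal_eta hT hl,
    lintegral_const_mul' _ _ ENNReal.ofReal_ne_top, lintegral_lintegral_swap hjoint,
    lintegral_renewalMeasure hT hη]
  congr 2
  -- After Tonelli, v < L_s is traded for T_v ≤ s, the event on which the Markov property at v was
  -- proved.
  obtain ⟨C, hC, h⟩ := hT.exists_countable hL s
  refine lintegral_congr_ae ((ae_restrict_Ici_pos_notMem hC).mono fun v hv => ?_)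
  dsimp only
  rw [← lintegral_exp_inverse_sub hT hL hl hst hv.1,
    ← lintegral_indicator (measurableSet_le (hT.measurable _) measurable_const)]
  refine lintegral_congr_ae ((h v hv.1 hv.2).mono fun ω hω => ?_)
  dsimp only
  by_cases hlt : v < inverse T s ω
  · rw [indicator_of_mem (show v ∈ {u : ℝ | u < (inverse T s ω : ℝ)} from hlt),
      indicator_of_mem (show ω ∈ {ω | T v.toNNReal ω ≤ s} from hω.2 hlt)]
  · rw [indicator_of_notMem (show v ∉ {u : ℝ | u < (inverse T s ω : ℝ)} from hlt),
      indicator_of_notMem (show ω ∉ {ω | T v.toNNReal ω ≤ s} from fun h => hlt (hω.1 h))]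

/-- The mean of `L_s` is the renewal function. -/
lemma lintegral_inverse [IsProbabilityMeasure P] (hT : IsSubordinator T P)
    (hL : ∀ t : ℝ, 0 ≤ t → ∀ᵐ ω ∂P, inverseTop T t ω < ∞) (s : ℝ) :
    ∫⁻ ω, ENNReal.ofReal (inverse T s ω) ∂P = renewalMeasure P T (Icc 0 s) := by
  have hms := hT.aemeasurable_inverse s
  rw [lintegral_eq_lintegral_meas_lt P (Eventually.of_forall fun ω => NNReal.coe_nonneg _)
    (by fun_prop), ← setLIntegral_one, lintegral_renewalMeasure hT measurable_const,
    setLIntegral_congr Ioi_ae_eq_Ici]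
  obtain ⟨C, hC, h⟩ := hT.exists_countable hL s
  refine lintegral_congr_ae ((ae_restrict_Ici_pos_notMem hC).mono fun v hv => ?_)
  dsimp only
  rw [setLIntegral_one, Measure.map_apply (hT.measurable _) measurableSet_Iic]
  exact measure_congr ((h v hv.1 hv.2).mono fun ω hω => (propext hω).symm)

/-- For t = s and l = 1 the mean of e^{-(L_t - L_s)} is 1, so the renewal formula forces η_s(1)
U([0,s]) ≤ 1, while η_s(1) > 0. -/
lemma renewalMeasure_Icc_lt_top [IsProbabilityMeasure P] (hT : IsSubordinator T P)
    (hL : ∀ t : ℝ, 0 ≤ t → ∀ᵐ ω ∂P, inverseTop T t ω < ∞) (s : ℝ) :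
    renewalMeasure P T (Icc 0 s) < ∞ := by
  have h := lintegral_exp_inverse_sub_inverse hT hL one_pos (le_refl s)
  simp only [sub_self, mul_zero, Real.exp_zero, ENNReal.ofReal_one, lintegral_const,
    measure_univ, mul_one, one_mul] at h
  have h1 : ENNReal.ofReal (eta P T s 1) * renewalMeasure P T (Icc 0 s) ≤ 1 := by
    rw [h, ← setLIntegral_const]
    refine le_trans ?_ le_add_self
    refine setLIntegral_mono' measurableSet_Icc fun r hr => ?_
    exact ENNReal.ofReal_le_ofReal (eta_antitone hT hL one_pos (by linarith [hr.1]))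
  by_contra! htop
  rw [top_le_iff.1 htop, ENNReal.mul_top (by simpa using eta_pos hT one_pos s)] at h1
  simp at h1

lemma integrable_inverse [IsProbabilityMeasure P] (hT : IsSubordinator T P)
    (hL : ∀ t : ℝ, 0 ≤ t → ∀ᵐ ω ∂P, inverseTop T t ω < ∞) (s : ℝ) :
    Integrable (fun ω => (inverse T s ω : ℝ)) P := by
  have hms := hT.aemeasurable_inverse s
  refine (lintegral_ofReal_ne_top_iff_integrable (by fun_prop)
    (Eventually.of_forall fun ω => NNReal.coe_nonneg _)).1 ?_
  rw [lintegral_inverse hT hL]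
  exact (renewalMeasure_Icc_lt_top hT hL s).ne

lemma integral_inverse [IsProbabilityMeasure P] (hT : IsSubordinator T P)
    (hL : ∀ t : ℝ, 0 ≤ t → ∀ᵐ ω ∂P, inverseTop T t ω < ∞) (s : ℝ) :
    ∫ ω, (inverse T s ω : ℝ) ∂P = (renewalMeasure P T).real (Icc 0 s) := by
  have hms := hT.aemeasurable_inverse s
  rw [integral_eq_lintegral_of_nonneg_ae (Eventually.of_forall fun ω => NNReal.coe_nonneg _)
    (by fun_prop), lintegral_inverse hT hL]
  rfl

lemma integrableOn_eta [IsProbabilityMeasure P] (hT : IsSubordinator T P)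
    (hL : ∀ t : ℝ, 0 ≤ t → ∀ᵐ ω ∂P, inverseTop T t ω < ∞) (hl : 0 < l) (s t : ℝ) :
    IntegrableOn (fun r => eta P T (t - r) l) (Icc 0 s) (renewalMeasure P T) := by
  have hη : Measurable fun r => eta P T (t - r) l :=
    (eta_antitone hT hL hl).measurable.comp (measurable_const.sub measurable_id)
  refine IntegrableOn.of_bound (renewalMeasure_Icc_lt_top hT hL s) hη.aestronglyMeasurable
    (eta P T (t - s) l) ?_
  refine (ae_restrict_mem measurableSet_Icc).mono fun r hr => ?_
  rw [Real.norm_of_nonneg (eta_nonneg _ _)]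
  exact eta_antitone hT hL hl (by linarith [hr.2])

/-- The mean of `exp (-l (L_t - L_s))` in terms of the renewal measure. -/
lemma integral_exp_inverse_sub_inverse [IsProbabilityMeasure P] (hT : IsSubordinator T P)
    (hL : ∀ t : ℝ, 0 ≤ t → ∀ᵐ ω ∂P, inverseTop T t ω < ∞) (hl : 0 < l) (hst : s ≤ t) :
    ∫ ω, Real.exp (-l * (inverse T t ω - inverse T s ω)) ∂P =
      l * (∫ r in Icc 0 s, eta P T (t - r) l ∂(renewalMeasure P T)) + eta P T t l := by
  have hmt := hT.aemeasurable_inverse t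
  have hms := hT.aemeasurable_inverse s
  have hI : 0 ≤ ∫ r in Icc 0 s, eta P T (t - r) l ∂(renewalMeasure P T) :=
    integral_nonneg fun _ => eta_nonneg _ _
  rw [integral_eq_lintegral_of_nonneg_ae (Eventually.of_forall fun ω => (Real.exp_pos _).le)
    (by fun_prop), lintegral_exp_inverse_sub_inverse hT hL hl hst,
    ← ofReal_integral_eq_lintegral_ofReal (integrableOn_eta hT hL hl s t)
      (Eventually.of_forall fun _ => eta_nonneg _ _), ← ENNReal.ofReal_mul hl.le,
    ← ENNReal.ofReal_add (eta_nonneg _ _) (mul_nonneg hl.le hI),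
    ENNReal.toReal_ofReal (add_nonneg (eta_nonneg _ _) (mul_nonneg hl.le hI)), add_comm]

/-- On [0, s] the integrand is at least η_t, and U([0,s]) = 𝔼[L_s]. -/
lemma le_integral_exp_inverse_sub_inverse [IsProbabilityMeasure P] (hT : IsSubordinator T P)
    (hL : ∀ t : ℝ, 0 ≤ t → ∀ᵐ ω ∂P, inverseTop T t ω < ∞) (hl : 0 < l) (s t : ℝ) :
    eta P T t l * (l * (∫ ω, (inverse T s ω : ℝ) ∂P) + 1) ≤
      l * (∫ r in Icc 0 s, eta P T (t - r) l ∂(renewalMeasure P T)) + eta P T t l := by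
  have h : eta P T t l * (renewalMeasure P T).real (Icc 0 s) ≤
      ∫ r in Icc 0 s, eta P T (t - r) l ∂(renewalMeasure P T) := by
    rw [mul_comm, ← smul_eq_mul, ← setIntegral_const]
    refine setIntegral_mono_on (integrableOn_const (renewalMeasure_Icc_lt_top hT hL s).ne)
      (integrableOn_eta hT hL hl s t) measurableSet_Icc fun r hr => ?_
    exact eta_antitone hT hL hl (by linarith [hr.1])
  rw [integral_inverse hT hL]
  nlinarith [mul_le_mul_of_nonneg_left h hl.le]

lemma integral_exp_inverse_sub_inverse_le [IsProbabilityMeasure P] (hT : IsSubordinator T P)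
    (hL : ∀ t : ℝ, 0 ≤ t → ∀ᵐ ω ∂P, inverseTop T t ω < ∞) (hl : 0 < l) (hs : 0 ≤ s) (t : ℝ) :
    l * (∫ r in Icc 0 s, eta P T (t - r) l ∂(renewalMeasure P T)) + eta P T t l ≤
      eta P T (t - s) l * (l * (∫ ω, (inverse T s ω : ℝ) ∂P) + 1) := by
  have h : ∫ r in Icc 0 s, eta P T (t - r) l ∂(renewalMeasure P T) ≤
      eta P T (t - s) l * (renewalMeasure P T).real (Icc 0 s) := by
    rw [mul_comm, ← smul_eq_mul, ← setIntegral_const]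
    refine setIntegral_mono_on (integrableOn_eta hT hL hl s t)
      (integrableOn_const (renewalMeasure_Icc_lt_top hT hL s).ne) measurableSet_Icc fun r hr => ?_
    exact eta_antitone hT hL hl (by linarith [hr.2])
  have h2 : eta P T t l ≤ eta P T (t - s) l := eta_antitone hT hL hl (by linarith)
  rw [integral_inverse hT hL]
  nlinarith [mul_le_mul_of_nonneg_left h hl.le]

end Subordinator

/-! ### Two-time laws of the Markov process and the eigensystem -/

section MarkovProcess

variable {Ω : Type*} [mΩ : MeasurableSpace Ω] {P : Measure Ω}
  {E : Type*} [MeasurableSpace E] {ν : Measure E}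
  {Q : TransitionSemigroup E} {ℱ : Filtration ℝ≥0 mΩ} {X : ℝ≥0 → Ω → E}

lemma inner_eq_integral (f g : Lp ℝ 2 ν) : inner ℝ f g = ∫ x, f x * g x ∂ν := by
  rw [L2.inner_def]
  exact integral_congr_ae (Eventually.of_forall fun x => by simp [mul_comm])

lemma memLp_comp {Y : Ω → E} (hY : AEMeasurable Y P) (hlaw : P.map Y = ν) (f : Lp ℝ 2 ν) :
    MemLp (fun ω => f (Y ω)) 2 P := by
  have h : MemLp f 2 (P.map Y) := hlaw.symm ▸ Lp.memLp f
  exact h.comp_of_map hY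

lemma IsMarkovProcess.measurable (hX : IsMarkovProcess X ℱ Q ν P) (t : ℝ≥0) :
    Measurable (X t) := (hX.adapted t).mono (ℱ.le t) le_rfl

variable [IsProbabilityMeasure P]

/-- The Markov property for indicators determines the joint law on rectangles. Through this law it
extends from bounded functions to products of L² functions. -/
lemma IsMarkovProcess.map_prodMk (hX : IsMarkovProcess X ℱ Q ν P) (s t : ℝ≥0) :
    P.map (fun ω => (X s ω, X (s + t) ω)) = (P.map (X s)) ⊗ₘ Q.kernel t := by
  have hms := hX.measurable s
  have hmt := hX.measurable (s + t)
  have := Q.markov t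
  have : IsProbabilityMeasure (P.map (X s)) := Measure.isProbabilityMeasure_map hms.aemeasurable
  have : IsProbabilityMeasure (P.map (fun ω => (X s ω, X (s + t) ω))) :=
    Measure.isProbabilityMeasure_map (hms.prodMk hmt).aemeasurable
  refine Measure.ext_prod fun {A B} hA hB => ?_
  rw [Measure.compProd_apply_prod hA hB, Measure.map_apply (hms.prodMk hmt) (hA.prod hB),
    setLIntegral_map hA (Kernel.measurable_coe _ hB) hms]
  have hind : Measurable (B.indicator fun _ => (1 : ℝ)) := measurable_const.indicator hB
  have hmark := hX.markov s t (B.indicator fun _ => 1) hind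
    ⟨1, fun x => by by_cases hx : x ∈ B <;> simp [hx]⟩
  have hintf : Integrable (fun ω => B.indicator (fun _ => (1 : ℝ)) (X (s + t) ω)) P := by
    refine Integrable.of_bound (C := 1) (hind.comp hmt).aestronglyMeasurable
      (Eventually.of_forall fun ω => ?_)
    by_cases hx : X (s + t) ω ∈ B <;> simp [hx]
  have hA' : MeasurableSet[ℱ s] (X s ⁻¹' A) := hX.adapted s hA
  have hA'' : MeasurableSet (X s ⁻¹' A) := hms hA
  have h1 := setIntegral_condExp (ℱ.le s) hintf hA'
  rw [setIntegral_congr_ae hA'' (hmark.mono fun ω h _ => h)] at h1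
  have h2 : ∫ ω in X s ⁻¹' A, B.indicator (fun _ => (1 : ℝ)) (X (s + t) ω) ∂P =
      P.real ((fun ω => (X s ω, X (s + t) ω)) ⁻¹' A ×ˢ B) := by
    have : (fun ω => B.indicator (fun _ => (1 : ℝ)) (X (s + t) ω)) =
        (X (s + t) ⁻¹' B).indicator 1 := by
      ext ω; rfl
    rw [this, integral_indicator_one (hmt hB), measureReal_restrict_apply' hA'', inter_comm]
    rfl
  have h3 : ∀ x, ∫ y, B.indicator (fun _ => (1 : ℝ)) y ∂(Q.kernel t x) = (Q.kernel t x B).toReal :=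
    fun x => by
      rw [show (B.indicator fun _ => (1 : ℝ)) = B.indicator 1 from rfl, integral_indicator_one hB]
      rfl
  simp only [h3, h2] at h1
  rw [integral_toReal (f := fun ω => Q.kernel t (X s ω) B)
    ((Kernel.measurable_coe _ hB).comp hms).aemeasurable
    (Eventually.of_forall fun ω => measure_lt_top _ _)] at h1
  refine ((ENNReal.toReal_eq_toReal_iff' ?_ (measure_ne_top _ _)).1 h1).symm
  refine ne_of_lt (lt_of_le_of_lt (setLIntegral_mono' hA'' fun ω _ => prob_le_one)
    (by simp))

variable [IsProbabilityMeasure ν]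

lemma IsMarkovProcess.map_eq (hX : IsMarkovProcess X ℱ Q ν P) (hν : Q.IsInvariant ν) (t : ℝ≥0) :
    P.map (X t) = ν := by
  have := Q.markov t
  have h := congrArg Measure.snd (hX.map_prodMk 0 t)
  rw [hX.initial, Measure.snd_compProd, (hν t).def, zero_add,
    Measure.snd_map_prodMk (hX.measurable 0)] at h
  exact h

lemma l2_coeFn (hν : Q.IsInvariant ν) (t : ℝ≥0) (f : Lp ℝ 2 ν) :
    Q.l2 ν hν t f =ᵐ[ν] fun x => ∫ y, f y ∂(Q.kernel t x) :=
  haveI := Q.markov t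
  MemLp.coeFn_toLp (memLp_kernel (Q.kernel t) ν (hν t) f)

lemma IsMarkovProcess.integral_mul (hX : IsMarkovProcess X ℱ Q ν P) (hν : Q.IsInvariant ν)
    (s t : ℝ≥0) (f g : Lp ℝ 2 ν) :
    ∫ ω, f (X (s + t) ω) * g (X s ω) ∂P = inner ℝ (Q.l2 ν hν t f) g := by
  have hms := hX.measurable s
  have hmt := hX.measurable (s + t)
  have := Q.markov t
  have hF : Measurable fun q : E × E => f q.2 * g q.1 :=
    ((Lp.stronglyMeasurable f).measurable.comp measurable_snd).mul
      ((Lp.stronglyMeasurable g).measurable.comp measurable_fst)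
  have hint : Integrable (fun ω => f (X (s + t) ω) * g (X s ω)) P :=
    (memLp_comp hmt.aemeasurable (hX.map_eq hν _) f).integrable_mul
      (memLp_comp hms.aemeasurable (hX.map_eq hν _) g)
  have hpair := (hms.prodMk hmt).aemeasurable (μ := P)
  have hlaw := hX.map_prodMk s t
  rw [hX.map_eq hν] at hlaw
  have hint' : Integrable (fun q : E × E => f q.2 * g q.1) (ν ⊗ₘ Q.kernel t) := by
    rw [← hlaw]
    exact (integrable_map_measure hF.aestronglyMeasurable hpair).2 hint
  calc ∫ ω, f (X (s + t) ω) * g (X s ω) ∂P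
      = ∫ q, f q.2 * g q.1 ∂(P.map fun ω => (X s ω, X (s + t) ω)) :=
        (integral_map hpair hF.aestronglyMeasurable).symm
    _ = ∫ x, ∫ y, f y * g x ∂(Q.kernel t x) ∂ν := by
        rw [hlaw, Measure.integral_compProd hint']
    _ = inner ℝ (Q.l2 ν hν t f) g := by
        rw [inner_eq_integral]
        refine integral_congr_ae ((l2_coeFn hν t f).mono fun x hx => ?_)
        dsimp only
        rw [hx, integral_mul_const]

lemma integral_l2 (hν : Q.IsInvariant ν) (t : ℝ≥0) (f : Lp ℝ 2 ν) :
    ∫ x, Q.l2 ν hν t f x ∂ν = ∫ x, f x ∂ν := by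
  have := Q.markov t
  have hlaw : (ν ⊗ₘ Q.kernel t).map Prod.snd = ν :=
    (Measure.snd_compProd ν (Q.kernel t)).trans (hν t).def
  have hf : AEStronglyMeasurable f ((ν ⊗ₘ Q.kernel t).map Prod.snd) :=
    (Lp.stronglyMeasurable f).aestronglyMeasurable
  have hint : Integrable (fun q : E × E => f q.2) (ν ⊗ₘ Q.kernel t) := by
    refine (integrable_map_measure hf measurable_snd.aemeasurable).1 ?_
    exact hlaw.symm ▸ (Lp.memLp f).integrable (by norm_num)
  calc ∫ x, Q.l2 ν hν t f x ∂ν = ∫ x, ∫ y, f y ∂(Q.kernel t x) ∂ν :=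
        integral_congr_ae (l2_coeFn hν t f)
    _ = ∫ q, f q.2 ∂(ν ⊗ₘ Q.kernel t) := (Measure.integral_compProd hint).symm
    _ = ∫ x, f x ∂((ν ⊗ₘ Q.kernel t).map Prod.snd) :=
        (integral_map measurable_snd.aemeasurable hf).symm
    _ = ∫ x, f x ∂ν := by rw [hlaw]

lemma l2_one (hν : Q.IsInvariant ν) (t : ℝ≥0) :
    Q.l2 ν hν t ((memLp_const (1 : ℝ)).toLp _) = (memLp_const (1 : ℝ)).toLp _ := by
  have := Q.markov t
  have h1 : ((memLp_const (1 : ℝ)).toLp _ : Lp ℝ 2 ν) =ᵐ[ν] fun _ => (1 : ℝ) :=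
    MemLp.coeFn_toLp _
  have h2 : ∀ᵐ y ∂(ν.bind (Q.kernel t)), ((memLp_const (1 : ℝ)).toLp _ : Lp ℝ 2 ν) y = 1 := by
    rw [(hν t).def]; exact h1
  refine Lp.ext ?_
  filter_upwards [l2_coeFn hν t ((memLp_const (1 : ℝ)).toLp _), h1,
    Measure.ae_ae_of_ae_comp h2] with x hx h1 h2
  rw [hx, h1, integral_congr_ae h2]
  simp

variable {N : Set ℕ} {lam : N → ℝ} {p v : N → Lp ℝ 2 ν} {hν : Q.IsInvariant ν}

/-- P_1 preserves the ν-mean yet multiplies it by e^{-λ_n} < 1. -/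
lemma IsEigenSystem.integral_p (h : IsEigenSystem Q ν hν N lam p v) {n : N} (hn : 0 < lam n) :
    ∫ x, p n x ∂ν = 0 := by
  have h1 := integral_l2 hν 1 (p n)
  rw [h.eigen, integral_congr_ae (Lp.coeFn_smul _ _)] at h1
  simp only [Pi.smul_apply, smul_eq_mul, integral_const_mul] at h1
  have h2 : Real.exp (-lam n * (1 : ℝ≥0)) < 1 := by
    rw [Real.exp_lt_one_iff]; simpa using hn
  exact mul_eq_zero.1 (show (1 - Real.exp (-lam n * (1 : ℝ≥0))) * ∫ x, p n x ∂ν = 0 by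
    linarith) |>.resolve_left (by linarith)

lemma inner_one (f : Lp ℝ 2 ν) : inner ℝ f ((memLp_const (1 : ℝ)).toLp _) = ∫ x, f x ∂ν := by
  rw [inner_eq_integral]
  refine integral_congr_ae ?_
  filter_upwards [MemLp.coeFn_toLp (memLp_const (1 : ℝ) (p := 2) (μ := ν))] with x hx
  rw [hx, mul_one]

/-- The adjoint eigenrelation is tested against the constant 1, which P_1 fixes. -/
lemma IsEigenSystem.integral_v (h : IsEigenSystem Q ν hν N lam p v) {n : N} (hn : 0 < lam n) :
    ∫ x, v n x ∂ν = 0 := by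
  have h1 := ContinuousLinearMap.adjoint_inner_left (Q.l2 ν hν 1)
    ((memLp_const (1 : ℝ)).toLp _) (v n)
  rw [h.coeigen, l2_one, real_inner_smul_left, inner_one] at h1
  have h2 : Real.exp (-lam n * (1 : ℝ≥0)) < 1 := by
    rw [Real.exp_lt_one_iff]; simpa using hn
  exact mul_eq_zero.1 (show (1 - Real.exp (-lam n * (1 : ℝ≥0))) * ∫ x, v n x ∂ν = 0 by
    linarith) |>.resolve_left (by linarith)

/-- Moving P_1 across the inner product gives (e^{-λ_n} - e^{-λ_m}) ⟨𝒫_m, 𝒱_n⟩ = 0, and the λ are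
distinct. -/
lemma IsEigenSystem.inner_eq (h : IsEigenSystem Q ν hν N lam p v) (m n : N) :
    inner ℝ (p m) (v n) = if m = n then 1 else 0 := by
  split_ifs with hmn
  · rw [hmn, h.normalized]
  · have h1 := ContinuousLinearMap.adjoint_inner_right (Q.l2 ν hν 1) (p m) (v n)
    rw [h.coeigen, h.eigen, real_inner_smul_left, real_inner_smul_right, ← sub_eq_zero,
      ← sub_mul] at h1
    refine (mul_eq_zero.1 h1).resolve_left fun h2 => hmn ?_
    have h3 := Real.exp_injective (sub_eq_zero.1 h2)
    simp only [NNReal.coe_one, mul_one, neg_inj] at h3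
    exact (h.distinct h3).symm

lemma IsEigenSystem.p_ne_zero (h : IsEigenSystem Q ν hν N lam p v) (n : N) : p n ≠ 0 := by
  intro h0
  have := h.normalized n
  simp [h0] at this

lemma IsEigenSystem.v_ne_zero (h : IsEigenSystem Q ν hν N lam p v) (n : N) : v n ≠ 0 := by
  intro h0
  have := h.normalized n
  simp [h0] at this

end MarkovProcess

/-! ### The time-changed process -/

section TimeChange

universe u

variable {Ω : Type u} [mΩ : MeasurableSpace Ω] {P : Measure Ω}
  {E : Type*} [MeasurableSpace E] {ν : Measure E} [IsProbabilityMeasure ν]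
  {Q : TransitionSemigroup E} {ℱ : Filtration ℝ≥0 mΩ} {X : ℝ≥0 → Ω → E} {T : ℝ≥0 → Ω → ℝ}

/-- A measurable process that is independent of `T` factors through a random variable that is
independent of the inverse of `T`. -/
lemma IsMeasurableIndep.exists_factor (hXT : IsMeasurableIndep X T P) (hT : IsSubordinator T P) :
    ∃ (Ω' : Type u) (_ : MeasurableSpace Ω') (i : Ω → Ω') (X' : ℝ≥0 × Ω' → E),
      Measurable i ∧ Measurable X' ∧ (∀ a ω, X' (a, i ω) = X a ω) ∧
      ∀ t s, IndepFun i (fun ω => (inverse T t ω, inverse T s ω)) P := by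
  have hae : ∀ t s, (fun ω => ((inverseRat T t ω).toNNReal, (inverseRat T s ω).toNNReal)) =ᵐ[P]
      fun ω => (inverse T t ω, inverse T s ω) := fun t s =>
    (hT.inverse_ae_eq t).symm.prodMk (hT.inverse_ae_eq s).symm
  obtain ⟨𝒢, h𝒢, hm, hind⟩ := hXT
  -- Ω' is Ω with the smaller σ-algebra 𝒢, so independence of 𝒢 from T becomes independence of the
  -- identity map.
  refine ⟨Ω, 𝒢, id, fun q => X q.1 q.2, measurable_id'' h𝒢, hm, fun _ _ => rfl, fun t s => ?_⟩
  have hZ : @Measurable _ _ (⨆ t : ℝ≥0, MeasurableSpace.comap (T t) inferInstance) _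
      fun ω => ((inverseRat T t ω).toNNReal, (inverseRat T s ω).toNNReal) := by
    let _ : MeasurableSpace Ω := ⨆ t : ℝ≥0, MeasurableSpace.comap (T t) inferInstance
    have hTm : ∀ t, Measurable (T t) := fun t =>
      measurable_iff_comap_le.2 (le_iSup (fun t => MeasurableSpace.comap (T t) inferInstance) t)
    exact (measurable_inverseRat hTm t).ennreal_toNNReal.prodMk
      (measurable_inverseRat hTm s).ennreal_toNNReal
  have h1 : @IndepFun _ _ _ mΩ 𝒢 _ id
      (fun ω => ((inverseRat T t ω).toNNReal, (inverseRat T s ω).toNNReal)) P := by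
    rw [IndepFun_iff_Indep, MeasurableSpace.comap_id]
    exact indep_of_indep_of_le_right hind (measurable_iff_comap_le.1 hZ)
  exact h1.congr EventuallyEq.rfl (hae t s)

lemma aemeasurable_timeChange (hXT : IsMeasurableIndep X T P) (hT : IsSubordinator T P) (t : ℝ) :
    AEMeasurable (timeChange X T t) P := by
  obtain ⟨Ω', _, i, X', hi, hX', hfac, -⟩ := hXT.exists_factor hT
  have := hX'.comp_aemeasurable ((hT.aemeasurable_inverse t).prodMk hi.aemeasurable)
  exact this.congr (Eventually.of_forall fun ω => hfac _ _)

variable [IsProbabilityMeasure P]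

/-- X has law ν at every fixed time, hence also at an independent random time. -/
lemma map_timeChange (hX : IsMarkovProcess X ℱ Q ν P) (hν : Q.IsInvariant ν)
    (hXT : IsMeasurableIndep X T P) (hT : IsSubordinator T P) (t : ℝ) :
    P.map (timeChange X T t) = ν := by
  have hm := aemeasurable_timeChange hXT hT t
  obtain ⟨Ω', _, i, X', hi, hX', hfac, hind⟩ := hXT.exists_factor hT
  have hZ : AEMeasurable (fun ω => (inverse T t ω, inverse T t ω)) P :=
    (hT.aemeasurable_inverse t).prodMk (hT.aemeasurable_inverse t)
  have hlaw := (hind t t).map_prod_eq_prod_map_map hi.aemeasurable hZ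
  have hpi := Measure.isProbabilityMeasure_map (μ := P) hi.aemeasurable
  have hpZ := Measure.isProbabilityMeasure_map hZ
  ext A hA
  have hG : Measurable fun q : Ω' × (ℝ≥0 × ℝ≥0) => X' (q.2.1, q.1) := by fun_prop
  have h1 : P.map (timeChange X T t) A =
      P.map (fun ω => (i ω, (inverse T t ω, inverse T t ω)))
        ((fun q : Ω' × (ℝ≥0 × ℝ≥0) => X' (q.2.1, q.1)) ⁻¹' A) := by
    rw [Measure.map_apply_of_aemeasurable hm hA,
      Measure.map_apply_of_aemeasurable (hi.aemeasurable.prodMk hZ) (hG hA)]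
    congr 1
    ext ω
    simp only [mem_preimage, hfac]
    rfl
  rw [h1, hlaw, Measure.prod_apply_symm (hG hA)]
  have h2 : ∀ z : ℝ≥0 × ℝ≥0, P.map i ((fun x => (x, z)) ⁻¹'
      ((fun q : Ω' × (ℝ≥0 × ℝ≥0) => X' (q.2.1, q.1)) ⁻¹' A)) = ν A := by
    intro z
    rw [Measure.map_apply hi (measurable_prodMk_right (hG hA)), ← hX.map_eq hν z.1,
      Measure.map_apply (hX.measurable _) hA]
    congr 1
    ext ω
    simp only [mem_preimage, hfac]
  simp [h2]

lemma memLp_timeChange (hX : IsMarkovProcess X ℱ Q ν P) (hν : Q.IsInvariant ν)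
    (hXT : IsMeasurableIndep X T P) (hT : IsSubordinator T P) (t : ℝ) (f : Lp ℝ 2 ν) :
    MemLp (fun ω => f (timeChange X T t ω)) 2 P :=
  memLp_comp (aemeasurable_timeChange hXT hT t) (map_timeChange hX hν hXT hT t) f

lemma integral_timeChange (hX : IsMarkovProcess X ℱ Q ν P) (hν : Q.IsInvariant ν)
    (hXT : IsMeasurableIndep X T P) (hT : IsSubordinator T P) (t : ℝ) {f : E → ℝ}
    (hf : Measurable f) :
    ∫ ω, f (timeChange X T t ω) ∂P = ∫ x, f x ∂ν := by
  rw [← map_timeChange hX hν hXT hT t, integral_map (aemeasurable_timeChange hXT hT t)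
    hf.aestronglyMeasurable]

lemma integral_timeChange_mul (hX : IsMarkovProcess X ℱ Q ν P) (hν : Q.IsInvariant ν)
    (hXT : IsMeasurableIndep X T P) (hT : IsSubordinator T P)
    (hL : ∀ t : ℝ, 0 ≤ t → ∀ᵐ ω ∂P, inverseTop T t ω < ∞) {s t l : ℝ} (hst : s ≤ t)
    {f : Lp ℝ 2 ν} (hf : ∀ u : ℝ≥0, Q.l2 ν hν u f = Real.exp (-l * u) • f) (g : Lp ℝ 2 ν) :
    ∫ ω, f (timeChange X T t ω) * g (timeChange X T s ω) ∂P =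
      inner ℝ f g * ∫ ω, Real.exp (-l * (inverse T t ω - inverse T s ω)) ∂P := by
  have hint : Integrable (fun ω => f (timeChange X T t ω) * g (timeChange X T s ω)) P :=
    (memLp_timeChange hX hν hXT hT t f).integrable_mul (memLp_timeChange hX hν hXT hT s g)
  obtain ⟨Ω', _, i, X', hi, hX', hfac, hind⟩ := hXT.exists_factor hT
  have hZ : AEMeasurable (fun ω => (inverse T t ω, inverse T s ω)) P :=
    (hT.aemeasurable_inverse t).prodMk (hT.aemeasurable_inverse s)
  have hlaw := (hind t s).map_prod_eq_prod_map_map hi.aemeasurable hZ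
  have hpi := Measure.isProbabilityMeasure_map (μ := P) hi.aemeasurable
  have hpZ := Measure.isProbabilityMeasure_map hZ
  have hfm := (Lp.stronglyMeasurable f).measurable
  have hgm := (Lp.stronglyMeasurable g).measurable
  set F : Ω' × (ℝ≥0 × ℝ≥0) → ℝ := fun q => f (X' (q.2.1, q.1)) * g (X' (q.2.2, q.1)) with hFdef
  have hF : Measurable F := by fun_prop
  have hFω : ∀ ω, F (i ω, (inverse T t ω, inverse T s ω)) =
      f (timeChange X T t ω) * g (timeChange X T s ω) := fun ω => by
    simp only [hFdef, hfac]; rfl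
  have hpair := hi.aemeasurable.prodMk hZ
  have hint' : Integrable F ((P.map i).prod (P.map fun ω => (inverse T t ω, inverse T s ω))) := by
    rw [← hlaw, integrable_map_measure hF.aestronglyMeasurable hpair]
    exact hint.congr (Eventually.of_forall fun ω => (hFω ω).symm)
  have hord : ∀ᵐ z ∂(P.map fun ω => (inverse T t ω, inverse T s ω)), z.2 ≤ z.1 := by
    rw [ae_map_iff hZ (measurableSet_le measurable_snd measurable_fst)]
    exact (ae_inverseTop_lt_top hL t).mono fun ω hω => inverse_mono hst hω
  -- With the two inverses frozen at b ≥ a, only the fixed-time covariance of X remains.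
  have hcond : ∀ z : ℝ≥0 × ℝ≥0, z.2 ≤ z.1 → ∫ x, F (x, z) ∂(P.map i) =
      inner ℝ f g * Real.exp (-l * ((z.1 : ℝ) - z.2)) := by
    rintro ⟨b, a⟩ hab
    have hFz : Measurable fun x => F (x, (b, a)) := hF.comp measurable_prodMk_right
    rw [integral_map hi.aemeasurable hFz.aestronglyMeasurable]
    simp only [hFdef, hfac]
    obtain ⟨c, rfl⟩ := exists_add_of_le (show a ≤ b from hab)
    rw [hX.integral_mul hν, hf, real_inner_smul_left]
    push_cast
    rw [add_sub_cancel_left, mul_comm]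
  calc ∫ ω, f (timeChange X T t ω) * g (timeChange X T s ω) ∂P
      = ∫ q, F q ∂(P.map fun ω => (i ω, (inverse T t ω, inverse T s ω))) := by
        rw [integral_map hpair hF.aestronglyMeasurable]
        exact integral_congr_ae (Eventually.of_forall fun ω => (hFω ω).symm)
    _ = ∫ z, ∫ x, F (x, z) ∂(P.map i) ∂(P.map fun ω => (inverse T t ω, inverse T s ω)) := by
        rw [hlaw, integral_prod_symm _ hint']
    _ = ∫ z, inner ℝ f g * Real.exp (-l * ((z.1 : ℝ) - z.2))
          ∂(P.map fun ω => (inverse T t ω, inverse T s ω)) :=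
        integral_congr_ae (hord.mono hcond)
    _ = _ := by
        rw [integral_map hZ (by fun_prop :
          Measurable fun z : ℝ≥0 × ℝ≥0 => inner ℝ f g * Real.exp (-l * ((z.1 : ℝ) - z.2))
          ).aestronglyMeasurable, integral_const_mul]

lemma std_timeChange (hX : IsMarkovProcess X ℱ Q ν P) (hν : Q.IsInvariant ν)
    (hXT : IsMeasurableIndep X T P) (hT : IsSubordinator T P) (t : ℝ) {f : Lp ℝ 2 ν}
    (hf : ∫ x, f x ∂ν = 0) : std P (fun ω => f (timeChange X T t ω)) = ‖f‖ := by
  have hfm := (Lp.stronglyMeasurable f).measurable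
  rw [std, covar, integral_timeChange hX hν hXT hT t hfm, hf,
    integral_timeChange hX hν hXT hT t (f := fun x => f x * f x) (by fun_prop),
    ← inner_eq_integral, real_inner_self_eq_norm_sq, mul_zero, sub_zero,
    Real.sqrt_sq (norm_nonneg _)]

/-- The correlation function of the time-changed process, for an eigenfunction `f`. -/
lemma corrL_eq (hX : IsMarkovProcess X ℱ Q ν P) (hν : Q.IsInvariant ν)
    (hXT : IsMeasurableIndep X T P) (hT : IsSubordinator T P)
    (hL : ∀ t : ℝ, 0 ≤ t → ∀ᵐ ω ∂P, inverseTop T t ω < ∞) {s t l : ℝ} (hl : 0 < l) (hst : s ≤ t)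
    {f g : Lp ℝ 2 ν} (hf : ∀ u : ℝ≥0, Q.l2 ν hν u f = Real.exp (-l * u) • f)
    (hf0 : ∫ x, f x ∂ν = 0) (hg0 : ∫ x, g x ∂ν = 0) (hfn : f ≠ 0) (hgn : g ≠ 0) :
    corrL P X T f g t s = inner ℝ f g / (‖f‖ * ‖g‖) *
      (l * (∫ r in Icc 0 s, eta P T (t - r) l ∂(renewalMeasure P T)) + eta P T t l) := by
  have hpos : 0 < ‖f‖ * ‖g‖ := mul_pos (norm_pos_iff.2 hfn) (norm_pos_iff.2 hgn)
  rw [corrL, corr, std_timeChange hX hν hXT hT t hf0, std_timeChange hX hν hXT hT s hg0,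
    if_pos hpos, covar, integral_timeChange_mul hX hν hXT hT hL hst hf,
    integral_timeChange hX hν hXT hT t (Lp.stronglyMeasurable f).measurable, hf0, zero_mul,
    sub_zero, integral_exp_inverse_sub_inverse hT hL hl hst]
  ring

end TimeChange

/-! ### From two-sided bounds to asymptotics -/

section Comparison

lemma exists_bound_of_limsup_eq {η : ℝ → ℝ} {s : ℝ} (hη : ∀ t, 0 < η t)
    (hC : ∃ C : ℝ, limsup (fun t : ℝ => ((η (t - s) / η t : ℝ) : EReal)) atTop = C) :
    ∃ t₀ R : ℝ, s ≤ t₀ ∧ 1 ≤ R ∧ ∀ t, t₀ ≤ t → η (t - s) ≤ R * η t := by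
  obtain ⟨C, hC⟩ := hC
  have hlt : limsup (fun t : ℝ => ((η (t - s) / η t : ℝ) : EReal)) atTop
      < ((max C 0 + 1 : ℝ) : EReal) := by
    rw [hC, EReal.coe_lt_coe_iff]
    linarith [le_max_left C 0]
  obtain ⟨a, ha⟩ := eventually_atTop.1 (eventually_lt_of_limsup_lt hlt)
  -- The constant lies strictly above the upper limit and is at least 1, as
  -- `comparableFrom_of_eq_mul` requires.
  refine ⟨max a s, max C 0 + 1, le_max_right _ _, by linarith [le_max_right C 0],
    fun t ht => ?_⟩
  have h := ha t ((le_max_left _ _).trans ht)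
  rw [EReal.coe_lt_coe_iff, div_lt_iff₀ (hη t)] at h
  exact h.le

/-- If `f = c Φ` with `g ≤ Φ ≤ R g`, then `f ≍ c g`, whatever the sign of `c`. -/
lemma comparableFrom_of_eq_mul {t₀ R c K : ℝ} {f Φ η : ℝ → ℝ} (hR : 1 ≤ R)
    (hf : ∀ t, t₀ ≤ t → f t = c * Φ t)
    (hΦ : ∀ t, t₀ ≤ t → 0 ≤ η t * K ∧ η t * K ≤ Φ t ∧ Φ t ≤ R * (η t * K)) :
    ComparableFrom t₀ f (fun t => c * η t * K) := by
  have hR0 : 0 < R := by linarith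
  have hinv : 1 / R ≤ 1 := by rw [one_div]; exact inv_le_one_of_one_le₀ hR
  rcases le_total 0 c with hc | hc
  · refine ⟨R, hR0, fun t ht => ?_⟩
    obtain ⟨h0, h1, h2⟩ := hΦ t ht
    dsimp only
    rw [hf t ht, mul_assoc c, mul_left_comm, mul_left_comm R]
    exact ⟨mul_le_mul_of_nonneg_left ((mul_le_of_le_one_left h0 hinv).trans h1) hc,
      mul_le_mul_of_nonneg_left h2 hc⟩
  -- A factor c ≤ 0 reverses the inequalities, so the constant is inverted.
  · refine ⟨1 / R, by positivity, fun t ht => ?_⟩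
    obtain ⟨h0, h1, h2⟩ := hΦ t ht
    dsimp only
    rw [hf t ht, mul_assoc c, one_div_one_div, mul_left_comm, mul_left_comm (1 / R)]
    exact ⟨mul_le_mul_of_nonpos_left h2 hc,
      mul_le_mul_of_nonpos_left ((mul_le_of_le_one_left h0 hinv).trans h1) hc⟩

/-- Φ / (ηK) is squeezed between 1 and η(t-s)/η(t), which tends to 1 as the inverse of a long-tail
ratio evaluated at t - s. -/
lemma isEquivalent_of_longTailed {η Φ : ℝ → ℝ} {s K : ℝ} (hs : 0 < s) (hη : ∀ t, 0 < η t)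
    (hK : 0 < K) (hlong : LongTailed η) (hlow : ∀ t, s ≤ t → η t * K ≤ Φ t)
    (hupp : ∀ t, s ≤ t → Φ t ≤ η (t - s) * K) :
    Asymptotics.IsEquivalent atTop Φ (fun t => η t * K) := by
  have hpos : ∀ t, 0 < η t * K := fun t => mul_pos (hη t) hK
  rw [Asymptotics.isEquivalent_iff_tendsto_one (Eventually.of_forall fun t => (hpos t).ne')]
  have h1 : Tendsto (fun t => η (t - s) / η t) atTop (𝓝 1) := by
    have h := ((hlong s hs).comp (tendsto_atTop_add_const_right atTop (-s) tendsto_id)).inv₀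
      one_ne_zero
    simpa [Function.comp_def, ← sub_eq_add_neg] using h
  refine tendsto_of_tendsto_of_tendsto_of_le_of_le' tendsto_const_nhds h1 ?_ ?_
  · filter_upwards [eventually_ge_atTop s] with t ht
    rw [Pi.div_apply, le_div_iff₀ (hpos t), one_mul]
    exact hlow t ht
  · filter_upwards [eventually_ge_atTop s] with t ht
    rw [Pi.div_apply, div_le_div_iff₀ (hpos t) (hη t)]
    have := hη t
    nlinarith [mul_le_mul_of_nonneg_right (hupp t ht) (hη t).le]

end Comparison

end SpectralCorrelation

/-! ### The main theorem -/

open SpectralCorrelation in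
theorem mainTheorem2
    {Ω : Type*} [mΩ : MeasurableSpace Ω] (P : Measure Ω) [IsProbabilityMeasure P]
    {E : Type*} [MeasurableSpace E] (ν : Measure E) [IsProbabilityMeasure ν]
    -- the Markov process `X`, started from its invariant probability measure `ν`
    (Q : TransitionSemigroup E) (hν : Q.IsInvariant ν)
    (ℱ : Filtration ℝ≥0 mΩ) (X : ℝ≥0 → Ω → E) (hX : IsMarkovProcess X ℱ Q ν P)
    -- the eigenfunctions and co-eigenfunctions
    (N : Set ℕ) (lam : N → ℝ) (p v : N → Lp ℝ 2 ν) (hpv : IsEigenSystem Q ν hν N lam p v)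
    -- the independent subordinator, with almost surely finite inverse
    (T : ℝ≥0 → Ω → ℝ) (hT : IsSubordinator T P) (hXT : IsMeasurableIndep X T P)
    (hL : ∀ t : ℝ, 0 ≤ t → ∀ᵐ ω ∂P, inverseTop T t ω < ∞)
    (m n : N) (hm : 0 < lam m) (hn : 0 < lam n) :
    -- the quantities below are finite
    (∀ t : ℝ, 0 < t → MemLp (fun ω => p m (timeChange X T t ω)) 2 P ∧
      MemLp (fun ω => v m (timeChange X T t ω)) 2 P) ∧
    (∀ s : ℝ, 0 < s → Integrable (fun ω => (inverse T s ω : ℝ)) P) ∧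
    (∀ s t : ℝ, 0 < s → s ≤ t →
      IntegrableOn (fun r => eta P T (t - r) (lam m)) (Icc 0 s) (renewalMeasure P T)) ∧
    -- the correlation functions
    (∀ s t : ℝ, 0 < s → s ≤ t →
      corrL P X T (p m) (p n) t s = cosAngle (p n) (p m) *
        (lam m * (∫ r in Icc 0 s, eta P T (t - r) (lam m) ∂(renewalMeasure P T))
          + eta P T t (lam m)) ∧
      corrL P X T (p m) (v n) t s = (condNumber (p m) (v m))⁻¹ * (if m = n then 1 else 0) *
        (lam m * (∫ r in Icc 0 s, eta P T (t - r) (lam m) ∂(renewalMeasure P T))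
          + eta P T t (lam m))) ∧
    -- the two-sided bounds
    (∀ s t : ℝ, 0 < s → s ≤ t →
      (0 ≤ cosAngle (p n) (p m) →
        cosAngle (p n) (p m) * eta P T t (lam m) * (lam m * (∫ ω, (inverse T s ω : ℝ) ∂P) + 1)
          ≤ corrL P X T (p m) (p n) t s ∧
        corrL P X T (p m) (p n) t s ≤ cosAngle (p n) (p m) * eta P T (t - s) (lam m) *
          (lam m * (∫ ω, (inverse T s ω : ℝ) ∂P) + 1)) ∧
      (cosAngle (p n) (p m) ≤ 0 →
        cosAngle (p n) (p m) * eta P T (t - s) (lam m) *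
            (lam m * (∫ ω, (inverse T s ω : ℝ) ∂P) + 1)
          ≤ corrL P X T (p m) (p n) t s ∧
        corrL P X T (p m) (p n) t s ≤ cosAngle (p n) (p m) * eta P T t (lam m) *
          (lam m * (∫ ω, (inverse T s ω : ℝ) ∂P) + 1)) ∧
      (condNumber (p m) (v m))⁻¹ * (if m = n then 1 else 0) * eta P T t (lam m) *
          (lam m * (∫ ω, (inverse T s ω : ℝ) ∂P) + 1)
        ≤ corrL P X T (p m) (v n) t s ∧
      corrL P X T (p m) (v n) t s ≤
        (condNumber (p m) (v m))⁻¹ * (if m = n then 1 else 0) * eta P T (t - s) (lam m) *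
          (lam m * (∫ ω, (inverse T s ω : ℝ) ∂P) + 1)) ∧
    -- comparability, if the upper limit of the ratio is finite
    (∀ s : ℝ, 0 < s →
      (∃ C : ℝ, limsup
        (fun t : ℝ => ((eta P T (t - s) (lam m) / eta P T t (lam m) : ℝ) : EReal)) atTop = C) →
      ∃ t₀ : ℝ, 0 < t₀ ∧
        ComparableFrom t₀ (fun t => corrL P X T (p m) (p n) t s)
          (fun t => cosAngle (p n) (p m) * eta P T t (lam m) *
            (lam m * (∫ ω, (inverse T s ω : ℝ) ∂P) + 1)) ∧
        ComparableFrom t₀ (fun t => corrL P X T (p m) (v n) t s)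
          (fun t => (condNumber (p m) (v m))⁻¹ * (if m = n then 1 else 0) * eta P T t (lam m) *
            (lam m * (∫ ω, (inverse T s ω : ℝ) ∂P) + 1))) ∧
    -- asymptotic equivalence in the long-tailed case
    (LongTailed (fun t => eta P T t (lam m)) → ∀ s : ℝ, 0 < s →
      Asymptotics.IsEquivalent atTop (fun t => corrL P X T (p m) (p n) t s)
        (fun t => cosAngle (p n) (p m) * eta P T t (lam m) *
          (lam m * (∫ ω, (inverse T s ω : ℝ) ∂P) + 1)) ∧
      Asymptotics.IsEquivalent atTop (fun t => corrL P X T (p m) (v n) t s)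
        (fun t => (condNumber (p m) (v m))⁻¹ * (if m = n then 1 else 0) * eta P T t (lam m) *
          (lam m * (∫ ω, (inverse T s ω : ℝ) ∂P) + 1))) := by
  have hp : ∀ s t : ℝ, 0 < s → s ≤ t →
      corrL P X T (p m) (p n) t s = cosAngle (p n) (p m) *
        (lam m * (∫ r in Icc 0 s, eta P T (t - r) (lam m) ∂(renewalMeasure P T))
          + eta P T t (lam m)) := fun s t _ hst => by
    rw [corrL_eq hX hν hXT hT hL hm hst (hpv.eigen m) (hpv.integral_p hm) (hpv.integral_p hn)
      (hpv.p_ne_zero m) (hpv.p_ne_zero n), cosAngle, real_inner_comm, mul_comm ‖p m‖]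
  have hv : ∀ s t : ℝ, 0 < s → s ≤ t →
      corrL P X T (p m) (v n) t s = (condNumber (p m) (v m))⁻¹ * (if m = n then 1 else 0) *
        (lam m * (∫ r in Icc 0 s, eta P T (t - r) (lam m) ∂(renewalMeasure P T))
          + eta P T t (lam m)) := fun s t _ hst => by
    rw [corrL_eq hX hν hXT hT hL hm hst (hpv.eigen m) (hpv.integral_p hm) (hpv.integral_v hn)
      (hpv.p_ne_zero m) (hpv.v_ne_zero n), hpv.inner_eq, condNumber]
    split_ifs with hmn
    · rw [hmn, one_div, mul_one]
    · simp
  have hκ : 0 ≤ (condNumber (p m) (v m))⁻¹ * (if m = n then (1 : ℝ) else 0) :=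
    mul_nonneg (inv_nonneg.2 (mul_nonneg (norm_nonneg _) (norm_nonneg _))) (by split_ifs <;> simp)
  have hlow : ∀ s t : ℝ, 0 < s → s ≤ t → eta P T t (lam m) *
      (lam m * (∫ ω, (inverse T s ω : ℝ) ∂P) + 1) ≤ lam m * (∫ r in Icc 0 s,
        eta P T (t - r) (lam m) ∂(renewalMeasure P T)) + eta P T t (lam m) :=
    fun s t _ _ => le_integral_exp_inverse_sub_inverse hT hL hm s t
  have hupp : ∀ s t : ℝ, 0 < s → s ≤ t → lam m * (∫ r in Icc 0 s,
        eta P T (t - r) (lam m) ∂(renewalMeasure P T)) + eta P T t (lam m) ≤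
      eta P T (t - s) (lam m) * (lam m * (∫ ω, (inverse T s ω : ℝ) ∂P) + 1) :=
    fun s t hs _ => integral_exp_inverse_sub_inverse_le hT hL hm hs.le t
  have hK : ∀ s : ℝ, 0 < lam m * (∫ ω, (inverse T s ω : ℝ) ∂P) + 1 := fun s => by
    have : 0 ≤ ∫ ω, (inverse T s ω : ℝ) ∂P := integral_nonneg fun _ => NNReal.coe_nonneg _
    positivity
  have hη : ∀ t, 0 < eta P T t (lam m) := eta_pos hT hm
  refine ⟨fun t _ => ⟨memLp_timeChange hX hν hXT hT t _, memLp_timeChange hX hν hXT hT t _⟩,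
    fun s _ => integrable_inverse hT hL s, fun s t _ _ => integrableOn_eta hT hL hm s t,
    fun s t hs hst => ⟨hp s t hs hst, hv s t hs hst⟩, fun s t hs hst => ?_,
    fun s hs hC => ?_, fun hlong s hs => ?_⟩
  · rw [hp s t hs hst, hv s t hs hst]
    simp only [mul_assoc _ (eta P T _ (lam m))]
    exact ⟨fun hc => ⟨mul_le_mul_of_nonneg_left (hlow s t hs hst) hc,
        mul_le_mul_of_nonneg_left (hupp s t hs hst) hc⟩,
      fun hc => ⟨mul_le_mul_of_nonpos_left (hupp s t hs hst) hc,
        mul_le_mul_of_nonpos_left (hlow s t hs hst) hc⟩,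
      mul_le_mul_of_nonneg_left (hlow s t hs hst) hκ,
      mul_le_mul_of_nonneg_left (hupp s t hs hst) hκ⟩
  · obtain ⟨t₀, R, hst, hR, h⟩ := exists_bound_of_limsup_eq (s := s) hη hC
    refine ⟨t₀, hs.trans_le hst, ?_, ?_⟩
    · refine comparableFrom_of_eq_mul (R := R) hR (fun t ht => hp s t hs (hst.trans ht))
        fun t ht => ⟨(mul_pos (hη t) (hK s)).le, hlow s t hs (hst.trans ht),
          (hupp s t hs (hst.trans ht)).trans ?_⟩
      rw [← mul_assoc]
      exact mul_le_mul_of_nonneg_right (h t ht) (hK s).le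
    · refine comparableFrom_of_eq_mul (R := R) hR (fun t ht => hv s t hs (hst.trans ht))
        fun t ht => ⟨(mul_pos (hη t) (hK s)).le, hlow s t hs (hst.trans ht),
          (hupp s t hs (hst.trans ht)).trans ?_⟩
      rw [← mul_assoc]
      exact mul_le_mul_of_nonneg_right (h t ht) (hK s).le
  · have hmain := isEquivalent_of_longTailed hs hη (hK s) hlong
      (fun t ht => hlow s t hs ht) (fun t ht => hupp s t hs ht)
    -- The constant is split off as a factor. Multiplication preserves `IsEquivalent` even when it
    -- is 0, both sides then vanishing eventually.
    simp only [mul_assoc _ (eta P T _ (lam m))]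
    exact ⟨(Asymptotics.IsEquivalent.refl.mul hmain).congr_left
        ((eventually_ge_atTop s).mono fun t ht => (hp s t hs ht).symm),
      (Asymptotics.IsEquivalent.refl.mul hmain).congr_left
        ((eventually_ge_atTop s).mono fun t ht => (hv s t hs ht).symm)⟩
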